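/- Let $\mathfrak g$ be a real nilpotent Lie algebra of finite dimension $n$ with a fixed Euclidean scalar product, let $G=\exp\mathfrak g$ be the connected, simply connected nilpotent Lie group with Lie algebra $\mathfrak g$, and let $0\le d\le n$. Let $\mathfrak h\subset\mathfrak g$ be a subalgebra of dimension $n-d$. A *Malcev basis of $\mathfrak g$ through $\mathfrak h$* is a basis $Z_1,\dots,Z_n$ of $\mathfrak g$ such that $\operatorname{span}\{Z_{d+1},\dots,Z_n\}=\mathfrak h$ and $\operatorname{span}\{Z_j,\dots,Z_n\}$ is a subalgebra of $\mathfrak g$ for every $1\le j\le d+1$. Then every $g\in G$ can be written in exactly one way as $g=E(t)h$ with $t\in\mathbb R^d$, $h\in H:=\exp\mathfrak h$ and $E(t)=\exp(t_1Z_1)\cdots\exp(t_dZ_d)$. For $\ell\in\mathfrak g^*$ with $\langle \ell,[\mathfrak h,\mathfrak h]\rangle=\{0\}$ let $\chi_\ell(\exp X)=e^{-2\pi i\langle\ell,X\rangle}$ $(X\in\mathfrak h)$ be the associated unitary character of $H$, and let $\sigma_{\ell,\mathfrak h}=\operatorname{ind}_H^G\chi_\ell$ be the induced unitary representation, realized on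 $L^2(\mathbb R^d)$ by means of the basis: with $\tilde\xi(E(t)h)=\chi_\ell(h^{-1})\,\xi(t)$, $$(\sigma_{\ell,\mathfrak h}(g)\xi)(t)=\tilde\xi\bigl(g^{-1}E(t)\bigr),\qquad \xi\in L^2(\mathbb R^d),\ g\in G,\ t\in\mathbb R^d .$$ The same letter denotes its extension to the group $C^*$-algebra $C^*(G)$, which on $F\in L^1(G)$ is $\sigma_{\ell,\mathfrak h}(F)=\int_G F(g)\,\sigma_{\ell,\mathfrak h}(g)\,dg$. **Proposition.** Let $(\ell_k)_{k\in\mathbb N}$ be a sequence in $\mathfrak g^*$ converging to $\ell\in\mathfrak g^*$. Let $(\mathfrak h_k)_k$ be a sequence of subalgebras of $\mathfrak g$ of dimension $n-d$ with $\langle\ell_k,[\mathfrak h_k,\mathfrak h_k]\rangle=\{0\}$ for all $k$. For every $k$ let $Z^k_1,\dots,Z^k_n$ be an orthonormal Malcev basis of $\mathfrak g$ through $\mathfrak h_k$, and suppose that $Z^k_j\to Z_j$ as $k\to\infty$ for every $j=1,\dots,n$. Then: 1. $\mathfrak h:=\operatorname{span}\{Z_{d+1},\dots,Z_n\}$ is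 a subalgebra of $\mathfrak g$, $\langle\ell,[\mathfrak h,\mathfrak h]\rangle=\{0\}$, and $Z_1,\dots,Z_n$ is an orthonormal Malcev basis of $\mathfrak g$ through $\mathfrak h$. 2. Let $\sigma_k=\sigma_{\ell_k,\mathfrak h_k}$ and $\sigma=\sigma_{\ell,\mathfrak h}$ be realized on $L^2(\mathbb R^d)$ by means of the bases $(Z^k_j)_j$ and $(Z_j)_j$ respectively. Then $\sigma_k$ converges weakly to $\sigma$: for all $\xi,\eta\in L^2(\mathbb R^d)$ and all $a\in C^*(G)$, $$\lim_{k\to\infty}\langle\sigma_k(a)\xi,\eta\rangle=\langle\sigma(a)\xi,\eta\rangle .$$ -/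

import Mathlib

set_option linter.unusedSectionVars false

/-- A multiplicative filtration of an algebra that vanishes in degree `c + 1`. -/
structure NilFiltration (E : Type*) [Ring E] [Algebra ℚ E] (c : ℕ) where
  F : ℕ → Submodule ℚ E
  anti : ∀ i, F (i + 1) ≤ F i
  mul_mem : ∀ i j a b, a ∈ F i → b ∈ F j → a * b ∈ F (i + j)
  bot : F (c + 1) = ⊥

namespace NilFiltration

section
variable {E : Type*} [Ring E] [Algebra ℚ E] {c : ℕ} (Φ : NilFiltration E c)

theorem anti' {i j : ℕ} (h : i ≤ j) : Φ.F j ≤ Φ.F i := antitone_nat_of_succ_le Φ.anti h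

theorem pow_mem {a : E} (ha : a ∈ Φ.F 1) (n : ℕ) : a ^ (n + 1) ∈ Φ.F (n + 1) := by
  induction n with
  | zero => simpa using ha
  | succ n ih => rw [pow_succ]; exact Φ.mul_mem _ _ _ _ ih ha

theorem pow_mem_one {a : E} (ha : a ∈ Φ.F 1) (n : ℕ) : a ^ (n + 1) ∈ Φ.F 1 :=
  Φ.anti' (by omega) (Φ.pow_mem ha n)

theorem pow_eq_zero {a : E} (ha : a ∈ Φ.F 1) : a ^ (c + 1) = 0 := by
  have := Φ.pow_mem ha c
  rwa [Φ.bot, Submodule.mem_bot] at this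

theorem nil {a : E} (ha : a ∈ Φ.F 1) : IsNilpotent a := ⟨_, Φ.pow_eq_zero ha⟩

theorem exp_eq {a : E} (ha : a ∈ Φ.F 1) :
    IsNilpotent.exp a = ∑ i ∈ Finset.range (c + 1), (i.factorial : ℚ)⁻¹ • a ^ i :=
  IsNilpotent.exp_eq_sum (Φ.pow_eq_zero ha)

theorem exp_sub_one_mem {a : E} (ha : a ∈ Φ.F 1) : IsNilpotent.exp a - 1 ∈ Φ.F 1 := by
  rw [Φ.exp_eq ha, Finset.sum_range_succ']
  simp only [Nat.factorial_zero, Nat.cast_one, inv_one, pow_zero, one_smul, add_sub_cancel_right]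
  exact Submodule.sum_mem _ fun i _ => Submodule.smul_mem _ _ (Φ.pow_mem_one ha i)

theorem pow_sub_mem {m : ℕ} {z w : E} (hz : z ∈ Φ.F 1) (hw : w ∈ Φ.F 1)
    (h : z - w ∈ Φ.F m) (n : ℕ) : z ^ (n + 2) - w ^ (n + 2) ∈ Φ.F (m + 1) := by
  have key : ∀ n, z ^ (n + 1) - w ^ (n + 1) ∈ Φ.F m := by
    intro n
    induction n with
    | zero => simpa using h
    | succ n ih =>
      have : z ^ (n + 2) - w ^ (n + 2)
          = z * (z ^ (n + 1) - w ^ (n + 1)) + (z - w) * w ^ (n + 1) := by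
        rw [pow_succ' z, pow_succ' w]; noncomm_ring
      rw [this]
      exact add_mem (Φ.anti' (by omega) (Φ.mul_mem _ _ _ _ hz ih))
        (Φ.anti' (by omega) (Φ.mul_mem _ _ _ _ h (Φ.pow_mem hw n)))
  have : z ^ (n + 2) - w ^ (n + 2)
      = z * (z ^ (n + 1) - w ^ (n + 1)) + (z - w) * w ^ (n + 1) := by
    rw [pow_succ' z, pow_succ' w]; noncomm_ring
  rw [this]
  exact add_mem (Φ.anti' (by omega) (Φ.mul_mem _ _ _ _ hz (key n)))
    (Φ.anti' (by omega) (Φ.mul_mem _ _ _ _ h (Φ.pow_mem hw n)))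

theorem exp_injective {z w : E} (hz : z ∈ Φ.F 1) (hw : w ∈ Φ.F 1)
    (h : IsNilpotent.exp z = IsNilpotent.exp w) : z = w := by
  have step : ∀ m, z - w ∈ Φ.F m → z - w ∈ Φ.F (m + 1) := by
    intro m hm
    rw [Φ.exp_eq hz, Φ.exp_eq hw] at h
    rcases c with _ | c
    · have : z - w ∈ Φ.F 1 := sub_mem hz hw
      rw [show (1 : ℕ) = 0 + 1 from rfl, Φ.bot, Submodule.mem_bot] at this
      rw [this]; exact zero_mem _
    · rw [Finset.sum_range_succ', Finset.sum_range_succ' (n := c + 1),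
        Finset.sum_range_succ', Finset.sum_range_succ' (n := c)] at h
      have h2 : z - w = ∑ i ∈ Finset.range c,
          ((i + 2).factorial : ℚ)⁻¹ • (w ^ (i + 2) - z ^ (i + 2)) := by
        simp only [smul_sub, Finset.sum_sub_distrib]
        simp at h
        rw [sub_eq_sub_iff_add_eq_add]
        rw [add_comm z, h, add_comm]
      rw [h2]
      refine Submodule.sum_mem _ fun i _ => Submodule.smul_mem _ _ ?_
      exact Φ.pow_sub_mem hw hz (by rw [← neg_sub]; exact neg_mem hm) i
  have all : ∀ m, z - w ∈ Φ.F (m + 1) := by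
    intro m
    induction m with
    | zero => exact sub_mem hz hw
    | succ m ih => exact step _ ih
  have := all c
  rw [Φ.bot, Submodule.mem_bot] at this
  exact sub_eq_zero.mp this

end
end NilFiltration

namespace BCHAux
open IsNilpotent

theorem exp_mulRight {A : Type*} [Ring A] [Algebra ℚ A] {a : A} (ha : IsNilpotent a) :
    exp (LinearMap.mulRight ℚ a) = LinearMap.mulRight ℚ (exp a) := by
  obtain ⟨k, hk⟩ := ha
  have hk' : (LinearMap.mulRight ℚ a) ^ k = 0 := by
    rw [LinearMap.pow_mulRight, hk]; ext; simp
  rw [exp_eq_sum hk, exp_eq_sum hk']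
  ext x
  simp [LinearMap.pow_mulRight, Finset.mul_sum]

theorem exp_mulLeft {A : Type*} [Ring A] [Algebra ℚ A] {a : A} (ha : IsNilpotent a) :
    exp (LinearMap.mulLeft ℚ a) = LinearMap.mulLeft ℚ (exp a) := by
  obtain ⟨k, hk⟩ := ha
  have hk' : (LinearMap.mulLeft ℚ a) ^ k = 0 := by
    rw [LinearMap.pow_mulLeft, hk]; ext; simp
  rw [exp_eq_sum hk, exp_eq_sum hk']
  ext x
  simp [LinearMap.pow_mulLeft, Finset.sum_mul]

/-- The operator `w ↦ z w - w z`. -/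
def ad {A : Type*} [Ring A] [Algebra ℚ A] (z : A) : Module.End ℚ A :=
  LinearMap.mulLeft ℚ z - LinearMap.mulRight ℚ z

theorem exp_conj {A : Type*} [Ring A] [Algebra ℚ A] {a : A} (ha : IsNilpotent a) (b : A) :
    exp (-ad a) b = exp (-a) * b * exp a := by
  have h1 : -ad a = LinearMap.mulLeft ℚ (-a) + LinearMap.mulRight ℚ a := by
    ext; simp [ad]; abel
  have hc : Commute (LinearMap.mulLeft ℚ (-a)) (LinearMap.mulRight ℚ a) := by
    ext; simp [mul_assoc]
  have hl : IsNilpotent (LinearMap.mulLeft ℚ (-a)) := by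
    obtain ⟨k, hk⟩ := ha.neg
    exact ⟨k, by rw [LinearMap.pow_mulLeft, hk]; ext; simp⟩
  have hr : IsNilpotent (LinearMap.mulRight ℚ a) := by
    obtain ⟨k, hk⟩ := ha
    exact ⟨k, by rw [LinearMap.pow_mulRight, hk]; ext; simp⟩
  rw [h1, exp_add_of_commute hc hl hr, exp_mulLeft ha.neg, exp_mulRight ha]
  simp [mul_assoc]

theorem isNilpotent_ad {A : Type*} [Ring A] [Algebra ℚ A] {a : A} (ha : IsNilpotent a) :
    IsNilpotent (ad a) := by
  have hc : Commute (LinearMap.mulLeft ℚ a) (LinearMap.mulRight ℚ a) := by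
    ext; simp [mul_assoc]
  have hl : IsNilpotent (LinearMap.mulLeft ℚ a) := by
    obtain ⟨k, hk⟩ := ha
    exact ⟨k, by rw [LinearMap.pow_mulLeft, hk]; ext; simp⟩
  have hr : IsNilpotent (LinearMap.mulRight ℚ a) := by
    obtain ⟨k, hk⟩ := ha
    exact ⟨k, by rw [LinearMap.pow_mulRight, hk]; ext; simp⟩
  exact hc.isNilpotent_sub hl hr

theorem exp_conj_sum {A : Type*} [Ring A] [Algebra ℚ A] {a : A} (ha : IsNilpotent a) :
    ∃ K, ∀ b, exp (-a) * b * exp a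
      = ∑ i ∈ Finset.range (K + 2), (i.factorial : ℚ)⁻¹ • ((-ad a) ^ i) b := by
  obtain ⟨K, hK⟩ := isNilpotent_ad ha
  have hK2 : (-ad a) ^ (K + 2) = 0 := by
    have h : (-ad a) ^ K = 0 := by
      rw [neg_pow (ad a) K]
      exact (congrArg _ hK).trans (mul_zero _)
    rw [pow_add, h]; exact zero_mul _
  refine ⟨K, fun b => ?_⟩
  rw [← exp_conj ha, exp_eq_sum hK2]
  simp

/-- Derivative of the exponential along a derivation. -/
theorem deriv_exp {A : Type*} [Ring A] [Algebra ℚ A] (D : A →ₗ[ℚ] A)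
    (hD : ∀ a b, D (a * b) = D a * b + a * D b) {z : A} (hz : IsNilpotent z) :
    ∃ K, D (exp z) = exp z * ∑ k ∈ Finset.range (K + 1),
      ((-1) ^ k * ((k + 1).factorial : ℚ)⁻¹) • ((ad z) ^ k) (D z) := by
  have hD1 : D 1 = 0 := by simpa using hD 1 1
  set Z : Module.End ℚ A := LinearMap.mulLeft ℚ z with hZ
  have hZn : IsNilpotent Z := by
    obtain ⟨k, hk⟩ := hz
    exact ⟨k, by rw [hZ, LinearMap.pow_mulLeft, hk]; ext; simp⟩
  obtain ⟨K, hK⟩ := exp_conj_sum hZn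
  have key : ∀ i, ((-ad Z) ^ (i + 1)) (D : Module.End ℚ A)
      = LinearMap.mulLeft ℚ ((-1 : ℚ) ^ i • ((ad z) ^ i) (D z)) := by
    intro i
    induction i with
    | zero =>
      ext w
      simp [ad, hZ, hD]
    | succ i ih =>
      rw [pow_succ' (-ad Z), Module.End.mul_apply, ih]
      ext w
      rw [pow_succ' (ad z), Module.End.mul_apply, pow_succ (-1 : ℚ)]
      generalize (ad z ^ i) (D z) = v
      simp [ad, hZ, smul_sub]
      rw [add_mul, neg_mul, smul_mul_assoc, smul_mul_assoc, mul_assoc, mul_assoc]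
      abel
  have h2 := congrArg (fun T : Module.End ℚ A => T 1) (hK D)
  rw [Finset.sum_range_succ'] at h2
  simp only [LinearMap.add_apply, LinearMap.sum_apply, LinearMap.smul_apply, key] at h2
  rw [exp_mulLeft hz, show -Z = LinearMap.mulLeft ℚ (-z) by ext; simp [hZ],
    exp_mulLeft hz.neg] at h2
  simp [hD1] at h2
  refine ⟨K, ?_⟩
  have h3 := congrArg (fun t => exp z * t) h2
  simp only [← mul_assoc, exp_mul_exp_neg_self hz, one_mul] at h3
  rw [h3]
  congr 1
  refine Finset.sum_congr rfl fun k _ => ?_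
  rw [smul_smul, mul_comm]

end BCHAux

namespace NilFiltration
open Polynomial
variable {E : Type*} [Ring E] [Algebra ℚ E] {c : ℕ} (Φ : NilFiltration E c)

/-- Polynomials with all coefficients in `S`. -/
def coeffIn (S : Submodule ℚ E) : Submodule ℚ E[X] where
  carrier := {p | ∀ n, p.coeff n ∈ S}
  add_mem' ha hb n := by rw [coeff_add]; exact add_mem (ha n) (hb n)
  zero_mem' n := by simp
  smul_mem' q p hp n := by rw [coeff_smul]; exact S.smul_mem q (hp n)

theorem mem_coeffIn {S : Submodule ℚ E} {p : E[X]} : p ∈ coeffIn S ↔ ∀ n, p.coeff n ∈ S := Iff.rfl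

/-- The coefficientwise filtration of the polynomial algebra. -/
noncomputable def poly : NilFiltration E[X] c where
  F m := coeffIn (Φ.F m)
  anti i p hp n := Φ.anti i (hp n)
  mul_mem i j a b ha hb n := by
    rw [coeff_mul]
    exact Submodule.sum_mem _ fun x _ => Φ.mul_mem _ _ _ _ (ha _) (hb _)
  bot := by
    rw [Φ.bot]
    ext p
    simp [mem_coeffIn, Polynomial.ext_iff]

theorem mem_poly {m : ℕ} {p : E[X]} : p ∈ Φ.poly.F m ↔ ∀ n, p.coeff n ∈ Φ.F m := Iff.rfl

theorem C_mem_coeffIn {S : Submodule ℚ E} {a : E} (ha : a ∈ S) : C a ∈ coeffIn S := by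
  intro n
  rw [coeff_C]
  split_ifs
  exacts [ha, zero_mem _]

theorem X_mul_C_mem_coeffIn {S : Submodule ℚ E} {a : E} (ha : a ∈ S) : X * C a ∈ coeffIn S := by
  intro n
  rcases n with _ | n
  · simp
  · rw [coeff_X_mul, coeff_C]
    split_ifs
    exacts [ha, zero_mem _]

/-- The derivative with respect to the polynomial variable. -/
noncomputable def der : E[X] →ₗ[ℚ] E[X] := (derivative (R := E)).restrictScalars ℚ

theorem der_mul (a b : E[X]) : der (a * b) = der a * b + a * der b := derivative_mul

/-- Evaluation at `1`. -/
noncomputable def ev1 : E[X] →+* E :=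
  Polynomial.eval₂RingHom' (RingHom.id E) 1 (fun _ => Commute.one_right _)

theorem ev1_apply (p : E[X]) : ev1 p = p.sum fun _ a => a := by
  simp [ev1, Polynomial.eval₂RingHom', Polynomial.eval₂_eq_sum]

theorem ev1_mem {S : Submodule ℚ E} {p : E[X]} (hp : p ∈ coeffIn S) : ev1 p ∈ S := by
  rw [ev1_apply]
  exact Submodule.sum_mem _ fun n _ => hp n

open IsNilpotent

theorem der_exp_of_commute {z : E[X]} (hz : IsNilpotent z) (h : Commute z (der z)) :
    der (exp z) = exp z * der z := by
  obtain ⟨K, hK⟩ := BCHAux.deriv_exp (A := E[X]) der der_mul hz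
  rw [hK, Finset.sum_range_succ']
  have : ∀ k, ((BCHAux.ad z) ^ (k + 1)) (der z) = 0 := by
    intro k
    rw [_root_.pow_succ (BCHAux.ad z), Module.End.mul_apply]
    have : BCHAux.ad z (der z) = 0 := by simp [BCHAux.ad, h.eq]
    rw [this, map_zero]
  simp [this]

/-- The truncated series of `log (1 + n)`. -/
noncomputable def nlog (c : ℕ) {E : Type*} [Ring E] [Algebra ℚ E] (n : E) : E :=
  ∑ k ∈ Finset.range c, ((-1 : ℚ) ^ k * ((k : ℚ) + 1)⁻¹) • n ^ (k + 1)

theorem nlog_mem {n : E} (hn : n ∈ Φ.F 1) : nlog c n ∈ Φ.F 1 :=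
  Submodule.sum_mem _ fun k _ => Submodule.smul_mem _ _ (Φ.pow_mem_one hn k)

theorem der_eq_zero {p : E[X]} (h : der p = 0) : p = C (p.coeff 0) := by
  ext n
  rcases n with _ | n
  · simp
  · have h1 : (derivative p).coeff n = 0 := by
      have : derivative p = 0 := h
      rw [this]; simp
    rw [coeff_derivative] at h1
    have h2 : ((n : ℚ) + 1) • p.coeff (n + 1) = 0 := by
      rw [← h1, Algebra.smul_def, Algebra.commutes]; simp
    rw [smul_eq_zero] at h2
    rcases h2 with h2 | h2
    · exact absurd h2 (by positivity)
    · rw [h2, coeff_C_succ]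

theorem exp_nlog {n : E} (hn : n ∈ Φ.F 1) : exp (nlog c n) = 1 + n := by
  set u : E[X] := X * C n with hu
  have huF : u ∈ Φ.poly.F 1 := X_mul_C_mem_coeffIn hn
  set L := nlog c u with hL
  have hLF : L ∈ Φ.poly.F 1 := Φ.poly.nlog_mem huF
  have hdu : der u = C n := by simp [der, hu]
  have hcu : Commute u (C n) := by
    simp only [hu, Commute, SemiconjBy]
    rw [mul_assoc, ← mul_assoc (C n), (Polynomial.commute_X (C n)).eq.symm, mul_assoc]
  have hdp : ∀ k : ℕ, der (u ^ (k + 1)) = ((k : ℚ) + 1) • (u ^ k * C n) := by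
    intro k
    induction k with
    | zero => simp [hdu]
    | succ k ih =>
      rw [_root_.pow_succ, der_mul, ih, hdu, smul_mul_assoc, mul_assoc, ← hcu.eq, ← mul_assoc,
        ← _root_.pow_succ]
      push_cast
      rw [add_smul ((k : ℚ) + 1) (1 : ℚ), one_smul]
  have hdL : der L = (∑ k ∈ Finset.range c, (-u) ^ k) * C n := by
    simp only [hL, nlog, map_sum, map_smul, hdp, smul_smul, Finset.sum_mul]
    refine Finset.sum_congr rfl fun k _ => ?_
    have : ((k : ℚ) + 1) ≠ 0 := by positivity
    rw [mul_assoc, inv_mul_cancel₀ this, mul_one, neg_pow u, ← smul_mul_assoc]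
    congr 1
    rw [Algebra.smul_def]; simp
  have hcL : Commute u L := by
    refine Commute.sum_right _ _ _ fun k _ => ?_
    exact ((Commute.refl u).pow_right _).smul_right _
  have hcuD : Commute u (der L) := by
    rw [hdL]
    refine Commute.mul_right (Commute.sum_right _ _ _ fun k _ => ?_) hcu
    exact ((Commute.refl u).neg_right).pow_right _
  have hcLD : Commute L (der L) := by
    refine Commute.sum_left _ _ _ fun k _ => ?_
    exact (hcuD.pow_left _).smul_left _
  have hgeo : der L * (1 + u) = C n := by
    have h0 : u ^ c * C n = 0 := by
      have : u ^ c * C n ∈ Φ.poly.F (c + 1) := by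
        rcases c with _ | c
        · rw [_root_.pow_zero, one_mul]; exact C_mem_coeffIn hn
        · exact Φ.poly.mul_mem _ _ _ _ (Φ.poly.pow_mem huF c) (C_mem_coeffIn hn)
      rwa [Φ.poly.bot, Submodule.mem_bot] at this
    have h1 := geom_sum_mul_neg (-u) c
    rw [hdL, mul_assoc, ((Commute.one_left (C n)).add_left hcu).eq.symm, ← mul_assoc]
    rw [sub_neg_eq_add] at h1
    rw [h1, sub_mul, one_mul, neg_pow u, mul_assoc, h0, mul_zero, sub_zero]
  have hd : der (exp (-L) * (1 + u)) = 0 := by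
    rw [der_mul, der_exp_of_commute (Φ.poly.nil hLF).neg (by
      rw [map_neg]; exact hcLD.neg_left.neg_right)]
    have : der (1 + u) = C n := by
      rw [map_add, hdu]; simp [der]
    rw [this, map_neg, mul_assoc, neg_mul, hgeo]
    simp
  have hconst := der_eq_zero hd
  have h0 : (exp (-L) * (1 + u)).coeff 0 = 1 := by
    have h1 : Polynomial.constantCoeff (exp (-L) * (1 + u)) = 1 := by
      rw [map_mul, map_exp (Φ.poly.nil hLF).neg]
      have hu0 : Polynomial.constantCoeff u = 0 := by simp [hu]
      have hL0 : Polynomial.constantCoeff L = 0 := by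
        simp only [hL, nlog, map_sum]
        refine Finset.sum_eq_zero fun k _ => ?_
        rw [map_rat_smul, map_pow, hu0]; simp
      rw [map_neg, hL0, map_add, hu0]; simp
    exact h1
  rw [h0, C_1] at hconst
  have h2 : exp L = 1 + u := by
    have := congrArg (fun t => exp L * t) hconst
    simp only [← mul_assoc, exp_mul_exp_neg_self (Φ.poly.nil hLF), one_mul, mul_one] at this
    exact this.symm
  have h3 := congrArg (ev1 (E := E)) h2
  rw [map_exp (Φ.poly.nil hLF)] at h3
  have h4 : ev1 u = n := by simp [hu, ev1, Polynomial.eval₂RingHom']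
  have h5 : ev1 L = nlog c n := by
    simp only [hL, nlog, map_sum]
    refine Finset.sum_congr rfl fun k _ => ?_
    rw [map_rat_smul, map_pow, h4]
  rw [h5, map_add, h4, map_one] at h3
  exact h3

theorem nlog_exp {z : E} (hz : z ∈ Φ.F 1) : nlog c (exp z - 1) = z := by
  have h := Φ.exp_sub_one_mem hz
  refine Φ.exp_injective (Φ.nlog_mem h) hz ?_
  rw [Φ.exp_nlog h]; abel

/-- `log (exp x exp y)` stays in any Lie subalgebra that contains `x` and `y`. -/
theorem exists_mem_exp_eq (S : Submodule ℚ E) (hS : S ≤ Φ.F 1)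
    (hlie : ∀ a ∈ S, ∀ b ∈ S, a * b - b * a ∈ S) {x y : E} (hx : x ∈ S) (hy : y ∈ S) :
    ∃ z ∈ S, exp z = exp x * exp y := by
  have hxF : C x ∈ Φ.poly.F 1 := C_mem_coeffIn (hS hx)
  have hyF : X * C y ∈ Φ.poly.F 1 := X_mul_C_mem_coeffIn (hS hy)
  set T : E[X] := exp (C x) * exp (X * C y) with hT
  have hTF : T - 1 ∈ Φ.poly.F 1 := by
    have : T - 1 = (exp (C x) - 1) * (exp (X * C y) - 1) + (exp (C x) - 1)
        + (exp (X * C y) - 1) := by rw [hT]; noncomm_ring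
    rw [this]
    refine add_mem (add_mem ?_ (Φ.poly.exp_sub_one_mem hxF)) (Φ.poly.exp_sub_one_mem hyF)
    exact Φ.poly.anti 1 (Φ.poly.mul_mem _ _ _ _ (Φ.poly.exp_sub_one_mem hxF)
      (Φ.poly.exp_sub_one_mem hyF))
  set z := nlog c (T - 1) with hz
  have hzF : z ∈ Φ.poly.F 1 := Φ.poly.nlog_mem hTF
  have hzT : exp z = T := by rw [hz, Φ.poly.exp_nlog hTF]; abel
  have hcy : Commute (X * C y : E[X]) (C y) := by
    simp only [Commute, SemiconjBy]
    rw [mul_assoc, ← mul_assoc (C y), (Polynomial.commute_X (C y)).eq.symm, mul_assoc]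
  have hdy : der (X * C y) = C y := by simp [der]
  have hdT : der T = T * C y := by
    have hdx : der (exp (C x)) = 0 := by
      have : der (C x) = 0 := by simp [der]
      rw [der_exp_of_commute (Φ.poly.nil hxF) (by rw [this]; exact Commute.zero_right _), this,
        mul_zero]
    rw [hT, der_mul, hdx, zero_mul, zero_add,
      der_exp_of_commute (Φ.poly.nil hyF) (by rw [hdy]; exact hcy), hdy, mul_assoc]
  obtain ⟨K, hK⟩ := BCHAux.deriv_exp (A := E[X]) der der_mul (Φ.poly.nil hzF)
  rw [hzT, hdT, ← hzT] at hK
  have hK2 := congrArg (fun t => exp (-z) * t) hK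
  simp only [← mul_assoc, exp_neg_mul_exp_self (Φ.poly.nil hzF), one_mul] at hK2
  rw [Finset.sum_range_succ'] at hK2
  have hz0 : z.coeff 0 = x := by
    refine Φ.exp_injective (hzF 0) (hS hx) ?_
    have := congrArg (Polynomial.constantCoeff) hzT
    rw [map_exp (Φ.poly.nil hzF), hT, map_mul, map_exp (Φ.poly.nil hxF),
      map_exp (Φ.poly.nil hyF)] at this
    simpa using this
  have main : ∀ m, z ∈ coeffIn (S ⊔ Φ.F (m + 1)) := by
    intro m
    induction m with
    | zero => exact fun n => Submodule.mem_sup_right (hzF n)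
    | succ m ih =>
      have hle : S ⊔ Φ.F (m + 1 + 1) ≤ S ⊔ Φ.F (m + 1) := sup_le_sup_left (Φ.anti _) _
      have hlie2 : ∀ a ∈ S ⊔ Φ.F (m + 1), ∀ b ∈ S ⊔ Φ.F (m + 1),
          a * b - b * a ∈ S ⊔ Φ.F (m + 1 + 1) := by
        intro a ha b hb
        obtain ⟨s, hs, f, hf, rfl⟩ := Submodule.mem_sup.mp ha
        obtain ⟨s', hs', f', hf', rfl⟩ := Submodule.mem_sup.mp hb
        have : (s + f) * (s' + f') - (s' + f') * (s + f) = (s * s' - s' * s)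
          + ((s * f' - f' * s) + (f * s' - s' * f) + (f * f' - f' * f)) := by noncomm_ring
        rw [this]
        refine Submodule.add_mem_sup (hlie _ hs _ hs') ?_
        have h1 : ∀ a b, a ∈ Φ.F 1 → b ∈ Φ.F (m + 1) → a * b - b * a ∈ Φ.F (m + 1 + 1) := by
          intro a b ha hb
          exact sub_mem (Φ.anti' (by omega) (Φ.mul_mem _ _ _ _ ha hb))
            (Φ.anti' (by omega) (Φ.mul_mem _ _ _ _ hb ha))
        refine add_mem (add_mem (h1 _ _ (hS hs) hf') ?_) (h1 _ _ (Φ.anti' (by omega) hf) hf')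
        rw [← neg_sub]; exact neg_mem (h1 _ _ (hS hs') hf)
      have had : ∀ w ∈ coeffIn (S ⊔ Φ.F (m + 1)),
          BCHAux.ad z w ∈ coeffIn (S ⊔ Φ.F (m + 1 + 1)) := by
        intro w hw n
        have : (BCHAux.ad z w).coeff n = ∑ p ∈ Finset.HasAntidiagonal.antidiagonal n,
            (z.coeff p.1 * w.coeff p.2 - w.coeff p.2 * z.coeff p.1) := by
          simp only [BCHAux.ad, LinearMap.sub_apply, LinearMap.mulLeft_apply,
            LinearMap.mulRight_apply, coeff_sub, coeff_mul, Finset.sum_sub_distrib]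
          congr 1
          rw [← Finset.Nat.sum_antidiagonal_swap]
          simp
        rw [this]
        exact Submodule.sum_mem _ fun p _ => hlie2 _ (ih _) _ (hw _)
      have hdz : der z ∈ coeffIn (S ⊔ Φ.F (m + 1)) := by
        intro n
        have : (der z).coeff n = ((n : ℚ) + 1) • z.coeff (n + 1) := by
          change (derivative z).coeff n = _
          rw [coeff_derivative, Algebra.smul_def, Algebra.commutes]; simp
        rw [this]
        exact Submodule.smul_mem _ _ (ih _)
      have hpow : ∀ k, (BCHAux.ad z ^ (k + 1)) (der z) ∈ coeffIn (S ⊔ Φ.F (m + 1 + 1)) := by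
        intro k
        induction k with
        | zero => simpa using had _ hdz
        | succ k ihk =>
          rw [_root_.pow_succ' (BCHAux.ad z), Module.End.mul_apply]
          exact had _ fun n => hle (ihk n)
      have hdz2 : der z ∈ coeffIn (S ⊔ Φ.F (m + 1 + 1)) := by
        have hsum : (∑ k ∈ Finset.range K, ((-1 : ℚ) ^ (k + 1) * ((k + 1 + 1).factorial : ℚ)⁻¹) •
            (BCHAux.ad z ^ (k + 1)) (der z)) ∈ coeffIn (S ⊔ Φ.F (m + 1 + 1)) :=
          Submodule.sum_mem _ fun k _ => Submodule.smul_mem _ _ (hpow k)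
        have hy2 : C y ∈ coeffIn (S ⊔ Φ.F (m + 1 + 1)) :=
          C_mem_coeffIn (Submodule.mem_sup_left hy)
        rw [hK2] at hy2
        have := sub_mem hy2 hsum
        simpa using this
      intro n
      rcases n with _ | n
      · rw [hz0]; exact Submodule.mem_sup_left hx
      · have : (der z).coeff n = ((n : ℚ) + 1) • z.coeff (n + 1) := by
          change (derivative z).coeff n = _
          rw [coeff_derivative, Algebra.smul_def, Algebra.commutes]; simp
        have h2 := hdz2 n
        rw [this] at h2
        have h3 := Submodule.smul_mem _ ((n : ℚ) + 1)⁻¹ h2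
        rwa [smul_smul, inv_mul_cancel₀ (by positivity), one_smul] at h3
  have hzS : z ∈ coeffIn S := by
    have := main c
    rwa [Φ.bot, sup_bot_eq] at this
  refine ⟨ev1 z, ev1_mem hzS, ?_⟩
  rw [← map_exp (Φ.poly.nil hzF), hzT, hT, map_mul, map_exp (Φ.poly.nil hxF),
    map_exp (Φ.poly.nil hyF)]
  simp [ev1, Polynomial.eval₂RingHom']

end NilFiltration

/-- The right-normed bracket `[x₁, [x₂, … [xₘ₋₁, xₘ] … ]]` of a word. -/
def nestedBracket {L : Type*} [LieRing L] : List L → L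
  | [] => 0
  | [x] => x
  | x :: y :: l => ⁅x, nestedBracket (y :: l)⁆

/-- The word `x^{r₁} y^{s₁} ⋯ x^{rₖ} y^{sₖ}` attached to `p = ((r₁,s₁), …, (rₖ,sₖ))`. -/
def dynkinWord {L : Type*} (x y : L) {k : ℕ} (p : Fin k → ℕ × ℕ) : List L :=
  (List.ofFn p).flatMap fun q => List.replicate q.1 x ++ List.replicate q.2 y

/-- The exponent pairs `(r, s) ≠ (0, 0)` with `r, s ≤ c`. -/
def dynkinPairs (c : ℕ) : Finset (ℕ × ℕ) :=
  (Finset.range (c + 1) ×ˢ Finset.range (c + 1)).erase (0, 0)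

/-- The Baker-Campbell-Hausdorff series in Dynkin's form,
`∑ₖ (-1)^{k-1}/k ∑ [x^{r₁} y^{s₁} ⋯ x^{rₖ} y^{sₖ}] / (∑ (rᵢ + sᵢ) ∏ rᵢ! sᵢ!)`, over `k ≥ 1` and
pairs `(rᵢ, sᵢ) ≠ (0, 0)`. The summation index `k` below is shifted by one, and terms with `k > c`,
`rᵢ > c` or `sᵢ > c` are left out: they are brackets of more than `c` letters, which vanish in a
Lie algebra of nilpotency class at most `c`. -/
noncomputable def dynkinBCH (K : Type*) [Field K] {L : Type*} [LieRing L] [LieAlgebra K L]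
    (c : ℕ) (x y : L) : L :=
  ∑ k ∈ Finset.range c, ∑ p ∈ Fintype.piFinset fun _ : Fin (k + 1) => dynkinPairs c,
    ((-1 : K) ^ k / (((k + 1 : ℕ) : K) * ((∑ i, ((p i).1 + (p i).2) : ℕ) : K)
      * ((∏ i, (p i).1.factorial * (p i).2.factorial : ℕ) : K))) •
      nestedBracket (dynkinWord x y p)

namespace BCHAux
open IsNilpotent TensorProduct

theorem map_nestedBracket {L M : Type*} [LieRing L] [LieRing M] (f : L → M) (h0 : f 0 = 0)
    (hf : ∀ x y, f ⁅x, y⁆ = ⁅f x, f y⁆) (l : List L) :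
    f (nestedBracket l) = nestedBracket (l.map f) := by
  induction l with
  | nil => simp [nestedBracket, h0]
  | cons x l ih =>
    rcases l with _ | ⟨y, l⟩
    · simp [nestedBracket]
    · simp only [nestedBracket, List.map_cons, hf]
      rw [ih]; simp

theorem map_dynkinWord {L M : Type*} (f : L → M) (x y : L) {k : ℕ} (p : Fin k → ℕ × ℕ) :
    (dynkinWord x y p).map f = dynkinWord (f x) (f y) p := by
  simp [dynkinWord, List.map_flatMap]

theorem map_dynkinBCH {K L M : Type*} [Field K] [LieRing L] [LieAlgebra K L]
    [LieRing M] [LieAlgebra K M] (f : L →ₗ[K] M) (hf : ∀ x y, f ⁅x, y⁆ = ⁅f x, f y⁆)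
    (c : ℕ) (x y : L) : f (dynkinBCH K c x y) = dynkinBCH K c (f x) (f y) := by
  simp only [dynkinBCH, map_sum, map_smul, map_nestedBracket f (map_zero f) hf, map_dynkinWord]

theorem length_dynkinWord {L : Type*} (x y : L) {k : ℕ} (p : Fin k → ℕ × ℕ) :
    (dynkinWord x y p).length = ∑ i, ((p i).1 + (p i).2) := by
  simp [dynkinWord, List.length_flatMap, List.sum_ofFn, Function.comp_def]

theorem length_pos_of_mem {k c : ℕ} {p : Fin (k + 1) → ℕ × ℕ}
    (hp : p ∈ Fintype.piFinset fun _ : Fin (k + 1) => dynkinPairs c) :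
    0 < ∑ i, ((p i).1 + (p i).2) := by
  have h0 := Fintype.mem_piFinset.mp hp 0
  have h1 : p 0 ≠ (0, 0) := Finset.ne_of_mem_erase h0
  have h2 : 0 < (p 0).1 + (p 0).2 := by
    by_contra h
    apply h1
    ext <;> simp <;> omega
  exact lt_of_lt_of_le h2
    (Finset.single_le_sum (f := fun i => (p i).1 + (p i).2) (fun _ _ => Nat.zero_le _)
      (Finset.mem_univ 0))

theorem mem_of_mem_dynkinWord {L : Type*} {x y : L} {k : ℕ} {p : Fin k → ℕ × ℕ} {w : L}
    (hw : w ∈ dynkinWord x y p) : w = x ∨ w = y := by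
  simp only [dynkinWord, List.mem_flatMap, List.mem_append, List.mem_replicate] at hw
  obtain ⟨q, -, h | h⟩ := hw
  exacts [Or.inl h.2, Or.inr h.2]

section rep
variable {L : Type*} [LieRing L] [LieAlgebra ℚ L] (δ : L →ₗ[ℚ] L)

/-- The representation `ρ(u) (v, s) = ([u, v] - s δ(u), 0)` defined by a derivation `δ`. -/
def rho : L →ₗ[ℚ] Module.End ℚ (L × ℚ) where
  toFun u := LinearMap.inl ℚ L ℚ ∘ₗ
    ((LieAlgebra.ad ℚ L u : L →ₗ[ℚ] L) ∘ₗ LinearMap.fst ℚ L ℚ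
      - (LinearMap.toSpanSingleton ℚ L (δ u)) ∘ₗ LinearMap.snd ℚ L ℚ)
  map_add' u v := by
    refine LinearMap.ext fun w => ?_
    simp [smul_add]; abel
  map_smul' q u := by
    refine LinearMap.ext fun w => ?_
    simp [smul_sub]
    rw [smul_comm]

theorem rho_apply (u : L) (w : L × ℚ) : rho δ u w = (⁅u, w.1⁆ - w.2 • δ u, 0) := by
  simp [rho]

variable {δ}

theorem rho_lie (hδ : ∀ u v, δ ⁅u, v⁆ = ⁅δ u, v⁆ + ⁅u, δ v⁆) (u v : L) :
    rho δ ⁅u, v⁆ = rho δ u * rho δ v - rho δ v * rho δ u := by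
  refine LinearMap.ext fun w => ?_
  simp only [rho_apply, LinearMap.sub_apply, Module.End.mul_apply, hδ, lie_sub, lie_smul,
    zero_smul, sub_zero, Prod.mk_sub_mk, lie_lie, smul_add]
  congr 1
  rw [← lie_skew v (δ u)]
  simp only [smul_neg]
  abel

variable (δ)

/-- The flag of `L × ℚ` given by the lower central series. -/
def flag (L : Type*) [LieRing L] [LieAlgebra ℚ L] : ℕ → Submodule ℚ (L × ℚ)
  | 0 => ⊤
  | j + 1 => (LieModule.lowerCentralSeries ℚ L L j).toSubmodule.prod ⊥

theorem flag_anti (j : ℕ) : flag L (j + 1) ≤ flag L j := by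
  rcases j with _ | j
  · exact le_top
  · exact Submodule.prod_mono (LieModule.antitone_lowerCentralSeries ℚ L L (Nat.le_succ j)) le_rfl

theorem flag_anti' : Antitone (flag L) := antitone_nat_of_succ_le flag_anti

/-- The filtration of the endomorphism algebra defined by the flag. -/
def flagFiltration (L : Type*) [LieRing L] [LieAlgebra ℚ L] (c : ℕ)
    (hc : LieModule.lowerCentralSeries ℤ L L c = ⊥) :
    NilFiltration (Module.End ℚ (L × ℚ)) c where
  F m :=
    { carrier := {T | ∀ j, ∀ v ∈ flag L j, T v ∈ flag L (j + m)}
      add_mem' := fun ha hb j v hv => add_mem (ha j v hv) (hb j v hv)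
      zero_mem' := fun j v _ => zero_mem _
      smul_mem' := fun q T hT j v hv => Submodule.smul_mem _ q (hT j v hv) }
  anti i T hT j v hv := flag_anti _ (hT j v hv)
  mul_mem i j a b ha hb k v hv := by
    have := ha _ _ (hb k v hv)
    rwa [show k + (i + j) = k + j + i by omega]
  bot := by
    have hc' : LieModule.lowerCentralSeries ℚ L L c = ⊥ := by
      apply SetLike.coe_injective
      rw [LieModule.coe_lowerCentralSeries_eq_int, hc]; rfl
    refine (Submodule.eq_bot_iff _).mpr fun T hT => ?_
    refine LinearMap.ext fun v => ?_
    have h := hT 0 v Submodule.mem_top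
    rw [zero_add] at h
    simp only [flag, hc'] at h
    obtain ⟨h1, h2⟩ := Submodule.mem_prod.mp h
    exact Prod.ext (by simpa using h1) (by simpa using h2)

theorem rho_mem (c : ℕ) (hc : LieModule.lowerCentralSeries ℤ L L c = ⊥) (u : L) :
    rho δ u ∈ (flagFiltration L c hc).F 1 := by
  intro j v hv
  rw [rho_apply]
  rcases j with _ | j
  · exact Submodule.mem_prod.mpr ⟨by simp, by simp⟩
  · obtain ⟨h1, h2⟩ := Submodule.mem_prod.mp hv
    have h2' : v.2 = 0 := by simpa using h2
    refine Submodule.mem_prod.mpr ⟨?_, by simp⟩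
    simp only [h2', zero_smul, sub_zero, LieSubmodule.mem_toSubmodule,
      LieModule.lowerCentralSeries_succ]
    exact LieSubmodule.lie_mem_lie (LieSubmodule.mem_top u) h1

theorem rho_prod_apply (l : List L) (hl : ∀ w ∈ l, δ w = w) (hne : l ≠ []) :
    (l.map (rho δ)).prod (0, 1) = (-nestedBracket l, 0) := by
  induction l with
  | nil => exact absurd rfl hne
  | cons x l ih =>
    rcases l with _ | ⟨y, l⟩
    · simp [rho_apply, nestedBracket, hl x (by simp)]
    · rw [List.map_cons, List.prod_cons, Module.End.mul_apply,
        ih (fun w hw => hl w (List.mem_cons_of_mem _ hw)) (by simp), rho_apply]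
      simp [nestedBracket]

variable {δ}

theorem der_nestedBracket (hδ : ∀ u v, δ ⁅u, v⁆ = ⁅δ u, v⁆ + ⁅u, δ v⁆) (l : List L)
    (hl : ∀ w ∈ l, δ w = w) : δ (nestedBracket l) = (l.length : ℚ) • nestedBracket l := by
  induction l with
  | nil => simp [nestedBracket]
  | cons x l ih =>
    rcases l with _ | ⟨y, l⟩
    · simp [nestedBracket, hl x (by simp)]
    · rw [nestedBracket, hδ, hl x (by simp), ih (fun w hw => hl w (List.mem_cons_of_mem _ hw)),
        lie_smul]
      simp only [List.length_cons]
      push_cast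
      rw [add_smul ((l.length : ℚ) + 1) (1 : ℚ), one_smul, add_comm]

/-- The Dynkin expansion of `log (exp (ρ x) exp (ρ y))`. -/
theorem nlog_apply (hδ : ∀ u v, δ ⁅u, v⁆ = ⁅δ u, v⁆ + ⁅u, δ v⁆) (c : ℕ)
    (hc : LieModule.lowerCentralSeries ℤ L L c = ⊥) (x y : L) (hx : δ x = x) (hy : δ y = y) :
    NilFiltration.nlog c (exp (rho δ x) * exp (rho δ y) - 1) (0, 1)
      = (-δ (dynkinBCH ℚ c x y), 0) := by
  have hxy : exp (rho δ x) * exp (rho δ y) - 1 = ∑ q ∈ dynkinPairs c,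
      ((q.1.factorial * q.2.factorial : ℕ) : ℚ)⁻¹ • (rho δ x ^ q.1 * rho δ y ^ q.2) := by
    rw [(flagFiltration L c hc).exp_eq (rho_mem δ c hc x),
      (flagFiltration L c hc).exp_eq (rho_mem δ c hc y), Finset.sum_mul_sum,
      ← Finset.sum_product', dynkinPairs, ← Finset.add_sum_erase _ _ (a := ((0 : ℕ), (0 : ℕ)))]
    · simp only [Nat.factorial_zero, Nat.cast_one, inv_one, _root_.pow_zero, one_smul, mul_one,
        add_sub_cancel_left]
      refine Finset.sum_congr rfl fun q _ => ?_
      rw [smul_mul_smul_comm]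
      push_cast
      rw [mul_inv]
    · simp
  have hpow : ∀ k : ℕ, (exp (rho δ x) * exp (rho δ y) - 1) ^ (k + 1)
      = ∑ p ∈ Fintype.piFinset fun _ : Fin (k + 1) => dynkinPairs c,
        ((∏ i, (p i).1.factorial * (p i).2.factorial : ℕ) : ℚ)⁻¹ •
          ((dynkinWord x y p).map (rho δ)).prod := by
    intro k
    have h := (MultilinearMap.mkPiAlgebraFin ℚ (k + 1) (Module.End ℚ (L × ℚ))).map_sum_finset
      (fun _ (q : ℕ × ℕ) => ((q.1.factorial * q.2.factorial : ℕ) : ℚ)⁻¹ •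
        (rho δ x ^ q.1 * rho δ y ^ q.2)) (fun _ => dynkinPairs c)
    rw [← hxy] at h
    simp only [MultilinearMap.mkPiAlgebraFin_apply, List.ofFn_const, List.prod_replicate] at h
    rw [h]
    refine Finset.sum_congr rfl fun p _ => ?_
    have h2 := (MultilinearMap.mkPiAlgebraFin ℚ (k + 1) (Module.End ℚ (L × ℚ))).map_smul_univ
      (fun i => (((p i).1.factorial * (p i).2.factorial : ℕ) : ℚ)⁻¹)
      (fun i => rho δ x ^ (p i).1 * rho δ y ^ (p i).2)
    simp only [MultilinearMap.mkPiAlgebraFin_apply] at h2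
    rw [h2]
    congr 1
    · push_cast
      rw [Finset.prod_inv_distrib]
    · rw [map_dynkinWord, dynkinWord, List.flatMap, List.prod_flatten, List.map_map,
        List.map_ofFn]
      congr 2
      funext i
      simp
  simp only [NilFiltration.nlog, hpow, dynkinBCH, map_sum, map_smul, LinearMap.sum_apply,
    LinearMap.smul_apply]
  have hδw : ∀ (k : ℕ) (p : Fin (k + 1) → ℕ × ℕ), ∀ w ∈ dynkinWord x y p, δ w = w := by
    intro k p w hw
    rcases mem_of_mem_dynkinWord hw with rfl | rfl
    exacts [hx, hy]
  have hterm : ∀ (k : ℕ), ∀ p ∈ Fintype.piFinset fun _ : Fin (k + 1) => dynkinPairs c,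
      ((dynkinWord x y p).map (rho δ)).prod (0, 1)
        = (-nestedBracket (dynkinWord x y p), 0) := by
    intro k p hp
    refine rho_prod_apply δ _ (hδw k p) ?_
    have := length_pos_of_mem hp
    rw [← length_dynkinWord x y p] at this
    exact List.ne_nil_of_length_pos this
  have hl : ∀ z : L, ((-z, 0) : L × ℚ) = LinearMap.inl ℚ L ℚ (-z) := fun z => rfl
  rw [hl, ← Finset.sum_neg_distrib, map_sum]
  refine Finset.sum_congr rfl fun k _ => ?_
  rw [← Finset.sum_neg_distrib, map_sum, Finset.smul_sum]
  refine Finset.sum_congr rfl fun p hp => ?_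
  rw [hterm k p hp, der_nestedBracket hδ _ (hδw k p), length_dynkinWord, hl, map_neg, map_neg,
    smul_neg, smul_neg, map_smul, map_smul, smul_smul, smul_smul]
  congr 2
  have h1 : ((∑ i, ((p i).1 + (p i).2) : ℕ) : ℚ) ≠ 0 :=
    Nat.cast_ne_zero.mpr (length_pos_of_mem hp).ne'
  have h2 : ((∏ i, (p i).1.factorial * (p i).2.factorial : ℕ) : ℚ) ≠ 0 := by
    refine Nat.cast_ne_zero.mpr (Finset.prod_ne_zero_iff.mpr fun i _ => ?_)
    exact Nat.mul_ne_zero (Nat.factorial_ne_zero _) (Nat.factorial_ne_zero _)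
  have h3 : ((k : ℚ) + 1) ≠ 0 := by positivity
  rw [Nat.cast_succ k]
  field_simp

end rep

end BCHAux

namespace BCHAux
open IsNilpotent TensorProduct

section poly
variable {L : Type*} [LieRing L] [LieAlgebra ℚ L]

/-- The Euler derivation `t d/dt` of `ℚ[t]`. -/
noncomputable def eulerD : Polynomial ℚ →ₗ[ℚ] Polynomial ℚ :=
  LinearMap.mulLeft ℚ Polynomial.X ∘ₗ Polynomial.derivative

theorem eulerD_mul (p q : Polynomial ℚ) : eulerD (p * q) = eulerD p * q + p * eulerD q := by
  simp [eulerD]; ring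

variable (L) in
/-- The Euler derivation `t d/dt` of `L[t]`. -/
noncomputable def euler : (Polynomial ℚ ⊗[ℚ] L) →ₗ[ℚ] (Polynomial ℚ ⊗[ℚ] L) :=
  LinearMap.rTensor L eulerD

theorem tlie_zero (u : Polynomial ℚ ⊗[ℚ] L) : ⁅u, (0 : Polynomial ℚ ⊗[ℚ] L)⁆ = 0 := lie_zero u

theorem tzero_lie (u : Polynomial ℚ ⊗[ℚ] L) : ⁅(0 : Polynomial ℚ ⊗[ℚ] L), u⁆ = 0 := zero_lie u

theorem tlie_add (u v w : Polynomial ℚ ⊗[ℚ] L) : ⁅u, v + w⁆ = ⁅u, v⁆ + ⁅u, w⁆ := lie_add u v w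

theorem tadd_lie (u v w : Polynomial ℚ ⊗[ℚ] L) : ⁅u + v, w⁆ = ⁅u, w⁆ + ⁅v, w⁆ := add_lie u v w

theorem euler_lie (u v : Polynomial ℚ ⊗[ℚ] L) :
    euler L ⁅u, v⁆ = ⁅euler L u, v⁆ + ⁅u, euler L v⁆ := by
  induction u using TensorProduct.induction_on with
  | zero => simp [tzero_lie]
  | add a b ha hb => simp only [tadd_lie, map_add, ha, hb]; abel
  | tmul p x =>
    induction v using TensorProduct.induction_on with
    | zero => simp [tlie_zero]
    | add a b ha hb => simp only [tlie_add, map_add, ha, hb]; abel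
    | tmul q y =>
      simp only [euler, LieAlgebra.ExtendScalars.bracket_tmul, LinearMap.rTensor_tmul, eulerD_mul,
        TensorProduct.add_tmul]

/-- Evaluation of `L[t]` at `t = q`. -/
noncomputable def evalL (q : ℚ) : (Polynomial ℚ ⊗[ℚ] L) →ₗ[ℚ] L :=
  (TensorProduct.lid ℚ L).toLinearMap ∘ₗ
    LinearMap.rTensor L (Polynomial.aeval q : Polynomial ℚ →ₐ[ℚ] ℚ).toLinearMap

theorem evalL_tmul (q : ℚ) (p : Polynomial ℚ) (x : L) :
    evalL q (p ⊗ₜ[ℚ] x) = p.eval q • x := by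
  simp [evalL, Polynomial.aeval_def, Polynomial.eval₂_eq_eval_map]

theorem evalL_lie (q : ℚ) (u v : Polynomial ℚ ⊗[ℚ] L) :
    evalL q ⁅u, v⁆ = ⁅evalL q u, evalL q v⁆ := by
  induction u using TensorProduct.induction_on with
  | zero => simp [tzero_lie]
  | add a b ha hb => simp only [tadd_lie, add_lie, map_add, ha, hb]
  | tmul p x =>
    induction v using TensorProduct.induction_on with
    | zero => simp [tlie_zero]
    | add a b ha hb => simp only [tlie_add, lie_add, map_add, ha, hb]
    | tmul q y =>
      simp [LieAlgebra.ExtendScalars.bracket_tmul, evalL_tmul, smul_smul, mul_comm]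

theorem eval_eq_of_euler_eq_zero {u : Polynomial ℚ ⊗[ℚ] L} (h : euler L u = 0) (q : ℚ) :
    u = 1 ⊗ₜ[ℚ] evalL q u := by
  set b := Module.Free.chooseBasis ℚ L
  set e := TensorProduct.equivFinsuppOfBasisRight (M := Polynomial ℚ) b
  have h1 : ∀ (v : Polynomial ℚ ⊗[ℚ] L) i, e (euler L v) i = eulerD (e v i) := by
    intro v i
    induction v using TensorProduct.induction_on with
    | zero => simp
    | add a b ha hb => simp only [map_add, Finsupp.add_apply, ha, hb]
    | tmul p x =>
      simp [euler, e]
  have h2 : ∀ i, e u i = Polynomial.C ((e u i).coeff 0) := by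
    intro i
    have : eulerD (e u i) = 0 := by rw [← h1, h]; simp
    simp only [eulerD, LinearMap.comp_apply, LinearMap.mulLeft_apply, mul_eq_zero,
      Polynomial.X_ne_zero, false_or] at this
    exact Polynomial.eq_C_of_derivative_eq_zero this
  have h3 : ∀ (v : Polynomial ℚ ⊗[ℚ] L) i, e (1 ⊗ₜ[ℚ] evalL q v) i
      = Polynomial.C ((e v i).eval q) := by
    intro v i
    induction v using TensorProduct.induction_on with
    | zero => simp
    | add a b ha hb =>
      simp only [map_add, Finsupp.add_apply, ha, hb, TensorProduct.tmul_add, Polynomial.eval_add]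
    | tmul p x =>
      simp [e, evalL_tmul,
        Polynomial.smul_eq_C_mul]
      ring
  apply e.injective
  ext1 i
  rw [h3, h2 i]
  simp

theorem evalL_eq {u v : Polynomial ℚ ⊗[ℚ] L} (h : euler L u = euler L v)
    (h0 : evalL 0 u = evalL 0 v) : u = v := by
  have h1 : euler L (u - v) = 0 := by rw [map_sub, h, sub_self]
  have h2 := eval_eq_of_euler_eq_zero h1 0
  rw [map_sub, h0, sub_self, TensorProduct.tmul_zero] at h2
  exact sub_eq_zero.mp h2

theorem lcs_poly {c : ℕ} (hc : LieModule.lowerCentralSeries ℤ L L c = ⊥) :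
    LieModule.lowerCentralSeries ℤ (Polynomial ℚ ⊗[ℚ] L) (Polynomial ℚ ⊗[ℚ] L) c = ⊥ := by
  have hc' : LieModule.lowerCentralSeries ℚ L L c = ⊥ := by
    apply SetLike.coe_injective
    rw [LieModule.coe_lowerCentralSeries_eq_int, hc]; rfl
  have h1 := LieSubmodule.lowerCentralSeries_tensor_eq_baseChange ℚ (Polynomial ℚ) L L c
  rw [hc', LieSubmodule.baseChange_bot] at h1
  apply SetLike.coe_injective
  rw [← LieModule.coe_lowerCentralSeries_eq_int (Polynomial ℚ), h1]; rfl

theorem dynkinBCH_zero (c : ℕ) : dynkinBCH ℚ c (0 : L) 0 = 0 := by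
  have := map_dynkinBCH (0 : L →ₗ[ℚ] L) (by simp) c 0 0
  simpa using this.symm

/-- The product filtration. -/
def prodFiltration {E E' : Type*} [Ring E] [Algebra ℚ E] [Ring E'] [Algebra ℚ E'] {c : ℕ}
    (Φ : NilFiltration E c) (Ψ : NilFiltration E' c) : NilFiltration (E × E') c where
  F m := (Φ.F m).prod (Ψ.F m)
  anti i := Submodule.prod_mono (Φ.anti i) (Ψ.anti i)
  mul_mem i j a b ha hb :=
    ⟨Φ.mul_mem _ _ _ _ ha.1 hb.1, Ψ.mul_mem _ _ _ _ ha.2 hb.2⟩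
  bot := by rw [Φ.bot, Ψ.bot, Submodule.prod_bot]

/-- The Baker-Campbell-Hausdorff theorem in Dynkin's form. -/
theorem exp_dynkinBCH {c : ℕ} (hc : LieModule.lowerCentralSeries ℤ L L c = ⊥)
    {E : Type*} [Ring E] [Algebra ℚ E] (Φ : NilFiltration E c) (R : L →ₗ[ℚ] E)
    (hR : ∀ u v, R ⁅u, v⁆ = R u * R v - R v * R u) (hF : ∀ u, R u ∈ Φ.F 1) (x y : L) :
    exp (R (dynkinBCH ℚ c x y)) = exp (R x) * exp (R y) := by
  set M := Polynomial ℚ ⊗[ℚ] L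
  have hcM : LieModule.lowerCentralSeries ℤ M M c = ⊥ := lcs_poly hc
  set Ψ := flagFiltration M c hcM
  set Ω := prodFiltration Φ Ψ
  set x' : M := (Polynomial.X : Polynomial ℚ) ⊗ₜ[ℚ] x with hx'
  set y' : M := (Polynomial.X : Polynomial ℚ) ⊗ₜ[ℚ] y with hy'
  set T : M →ₗ[ℚ] E × Module.End ℚ (M × ℚ) := (R ∘ₗ evalL 1).prod (rho (euler L)) with hT
  set S : Submodule ℚ (E × Module.End ℚ (M × ℚ)) := (LinearMap.ker (evalL (L := L) 0)).map T
  have hSF : S ≤ Ω.F 1 := by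
    rintro _ ⟨u, -, rfl⟩
    exact ⟨hF _, rho_mem _ c hcM u⟩
  have hTl : ∀ u v, T ⁅u, v⁆ = T u * T v - T v * T u := by
    intro u v
    refine Prod.ext ?_ ?_
    · change R (evalL 1 ⁅u, v⁆) = R (evalL 1 u) * R (evalL 1 v) - R (evalL 1 v) * R (evalL 1 u)
      rw [← hR]; exact congrArg R (evalL_lie 1 u v)
    · simpa [hT] using rho_lie euler_lie u v
  have hSl : ∀ a ∈ S, ∀ b ∈ S, a * b - b * a ∈ S := by
    rintro _ ⟨u, hu, rfl⟩ _ ⟨v, hv, rfl⟩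
    refine ⟨⁅u, v⁆, ?_, hTl u v⟩
    have hu' : evalL 0 u = 0 := hu
    change evalL 0 _ = 0
    rw [evalL_lie, hu', zero_lie]
  have hX : ∀ w : L, evalL 0 ((Polynomial.X : Polynomial ℚ) ⊗ₜ[ℚ] w) = 0 := by
    intro w; simp [evalL_tmul]
  have hX1 : ∀ w : L, evalL 1 ((Polynomial.X : Polynomial ℚ) ⊗ₜ[ℚ] w) = w := by
    intro w; simp [evalL_tmul]
  have hXe : ∀ w : L, euler L ((Polynomial.X : Polynomial ℚ) ⊗ₜ[ℚ] w)
      = (Polynomial.X : Polynomial ℚ) ⊗ₜ[ℚ] w := by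
    intro w; simp [euler, eulerD]
  have hxS : T x' ∈ S := ⟨x', hX x, rfl⟩
  have hyS : T y' ∈ S := ⟨y', hX y, rfl⟩
  obtain ⟨_, ⟨Z, hZ, rfl⟩, hexp⟩ := Ω.exists_mem_exp_eq S hSF hSl hxS hyS
  have hZ0 : evalL 0 Z = 0 := hZ
  have hZS : T Z ∈ S := ⟨Z, hZ, rfl⟩
  have e1 := congrArg (RingHom.fst E (Module.End ℚ (M × ℚ))) hexp
  have e2 := congrArg (RingHom.snd E (Module.End ℚ (M × ℚ))) hexp
  rw [map_mul, map_exp (Ω.nil (hSF hZS)), map_exp (Ω.nil (hSF hxS)),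
    map_exp (Ω.nil (hSF hyS))] at e1 e2
  have e1' : exp (R (evalL 1 Z)) = exp (R x) * exp (R y) := by
    have : exp (R (evalL 1 Z)) = exp (R (evalL 1 x')) * exp (R (evalL 1 y')) := e1
    rwa [hx', hy', hX1, hX1] at this
  have e2' : exp (rho (euler L) Z) = exp (rho (euler L) x') * exp (rho (euler L) y') := e2
  have h3 := nlog_apply (δ := euler L) euler_lie c hcM x' y' (hXe x) (hXe y)
  rw [← e2', Ψ.nlog_exp (rho_mem _ c hcM Z), rho_apply] at h3
  have h4 : euler L Z = euler L (dynkinBCH ℚ c x' y') := by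
    have h := congrArg Prod.fst h3
    simp only [lie_zero, one_smul, zero_sub] at h
    exact neg_injective h
  have h5 : Z = dynkinBCH ℚ c x' y' := by
    refine evalL_eq h4 ?_
    rw [hZ0, map_dynkinBCH _ (evalL_lie 0), hx', hy', hX, hX, dynkinBCH_zero]
  rw [← e1', h5, map_dynkinBCH _ (evalL_lie 1), hx', hy', hX1, hX1]

theorem eq_of_exp_rho {c : ℕ} (hc : LieModule.lowerCentralSeries ℤ L L c = ⊥)
    {u v : Polynomial ℚ ⊗[ℚ] L} (h0 : evalL 0 u = evalL 0 v)
    (h : exp (rho (euler L) u) = exp (rho (euler L) v)) : u = v := by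
  have h1 := (flagFiltration _ c (lcs_poly hc)).exp_injective
    (rho_mem _ c (lcs_poly hc) u) (rho_mem _ c (lcs_poly hc) v) h
  refine evalL_eq ?_ h0
  have := congrArg (fun T : Module.End ℚ _ => (T (0, 1)).1) h1
  simpa [rho_apply] using this

theorem exp_rho_dynkinBCH {c : ℕ} (hc : LieModule.lowerCentralSeries ℤ L L c = ⊥)
    (u v : Polynomial ℚ ⊗[ℚ] L) : exp (rho (euler L) (dynkinBCH ℚ c u v))
      = exp (rho (euler L) u) * exp (rho (euler L) v) :=
  exp_dynkinBCH (lcs_poly hc) (flagFiltration _ c (lcs_poly hc)) _ (rho_lie euler_lie)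
    (rho_mem _ c (lcs_poly hc)) u v

theorem evalX (q : ℚ) (w : L) : evalL q ((Polynomial.X : Polynomial ℚ) ⊗ₜ[ℚ] w) = q • w := by
  simp [evalL_tmul]

theorem bch_assoc {c : ℕ} (hc : LieModule.lowerCentralSeries ℤ L L c = ⊥) (x y z : L) :
    dynkinBCH ℚ c (dynkinBCH ℚ c x y) z = dynkinBCH ℚ c x (dynkinBCH ℚ c y z) := by
  set X : L → Polynomial ℚ ⊗[ℚ] L := fun w => (Polynomial.X : Polynomial ℚ) ⊗ₜ[ℚ] w with hX
  have h : dynkinBCH ℚ c (dynkinBCH ℚ c (X x) (X y)) (X z)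
      = dynkinBCH ℚ c (X x) (dynkinBCH ℚ c (X y) (X z)) := by
    refine eq_of_exp_rho hc ?_ ?_
    · simp [map_dynkinBCH _ (evalL_lie 0), hX, evalX, dynkinBCH_zero]
    · simp only [exp_rho_dynkinBCH hc, mul_assoc]
  have := congrArg (evalL 1) h
  simpa [map_dynkinBCH _ (evalL_lie 1), hX, evalX] using this

theorem bch_zero_left {c : ℕ} (hc : LieModule.lowerCentralSeries ℤ L L c = ⊥) (x : L) :
    dynkinBCH ℚ c 0 x = x := by
  set X : L → Polynomial ℚ ⊗[ℚ] L := fun w => (Polynomial.X : Polynomial ℚ) ⊗ₜ[ℚ] w with hX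
  have h : dynkinBCH ℚ c 0 (X x) = X x := by
    refine eq_of_exp_rho hc ?_ ?_
    · simp [map_dynkinBCH _ (evalL_lie 0), hX, evalX, dynkinBCH_zero]
    · rw [exp_rho_dynkinBCH hc]; simp
  have := congrArg (evalL 1) h
  simpa [map_dynkinBCH _ (evalL_lie 1), hX, evalX] using this

theorem bch_zero_right {c : ℕ} (hc : LieModule.lowerCentralSeries ℤ L L c = ⊥) (x : L) :
    dynkinBCH ℚ c x 0 = x := by
  set X : L → Polynomial ℚ ⊗[ℚ] L := fun w => (Polynomial.X : Polynomial ℚ) ⊗ₜ[ℚ] w with hX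
  have h : dynkinBCH ℚ c (X x) 0 = X x := by
    refine eq_of_exp_rho hc ?_ ?_
    · simp [map_dynkinBCH _ (evalL_lie 0), hX, evalX, dynkinBCH_zero]
    · rw [exp_rho_dynkinBCH hc]; simp
  have := congrArg (evalL 1) h
  simpa [map_dynkinBCH _ (evalL_lie 1), hX, evalX] using this

theorem bch_neg_left {c : ℕ} (hc : LieModule.lowerCentralSeries ℤ L L c = ⊥) (x : L) :
    dynkinBCH ℚ c (-x) x = 0 := by
  set X : L → Polynomial ℚ ⊗[ℚ] L := fun w => (Polynomial.X : Polynomial ℚ) ⊗ₜ[ℚ] w with hX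
  have h : dynkinBCH ℚ c (-(X x)) (X x) = 0 := by
    refine eq_of_exp_rho hc ?_ ?_
    · simp [map_dynkinBCH _ (evalL_lie 0), hX, evalX, dynkinBCH_zero]
    · rw [exp_rho_dynkinBCH hc, map_neg, exp_neg_mul_exp_self
        ((flagFiltration _ c (lcs_poly hc)).nil (rho_mem _ c (lcs_poly hc) _))]
      simp
  have := congrArg (evalL 1) h
  simpa [map_dynkinBCH _ (evalL_lie 1), hX, evalX] using this

end poly

section real
variable {K : Type*} [Field K] [CharZero K] {L : Type*} [LieRing L] [LieAlgebra K L]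

theorem dynkinBCH_rat [LieAlgebra ℚ L] (c : ℕ) (x y : L) :
    dynkinBCH K c x y = dynkinBCH ℚ c x y := by
  have h : ∀ (q : ℚ) (v : L), (q : K) • v = q • v := by
    intro q v
    exact Rat.cast_smul_eq_qsmul K q v
  simp only [dynkinBCH]
  refine Finset.sum_congr rfl fun k _ => Finset.sum_congr rfl fun p _ => ?_
  rw [← h]
  push_cast
  rfl

variable (K L) in
/-- Restriction of scalars to `ℚ`. -/
abbrev ratLieAlgebra : LieAlgebra ℚ L :=
  letI : Module ℚ L := Module.compHom L (algebraMap ℚ K)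
  { lie_smul := fun q x y => lie_smul (algebraMap ℚ K q) x y }

theorem dynkinBCH_assoc {c : ℕ} (hc : LieModule.lowerCentralSeries ℤ L L c = ⊥) (x y z : L) :
    dynkinBCH K c (dynkinBCH K c x y) z = dynkinBCH K c x (dynkinBCH K c y z) := by
  let _ := ratLieAlgebra K L
  simp only [dynkinBCH_rat]
  exact bch_assoc hc x y z

theorem dynkinBCH_zero_left {c : ℕ} (hc : LieModule.lowerCentralSeries ℤ L L c = ⊥) (x : L) : dynkinBCH K c 0 x = x := by
  let _ := ratLieAlgebra K L
  simp only [dynkinBCH_rat]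
  exact bch_zero_left hc x

theorem dynkinBCH_zero_right {c : ℕ} (hc : LieModule.lowerCentralSeries ℤ L L c = ⊥) (x : L) : dynkinBCH K c x 0 = x := by
  let _ := ratLieAlgebra K L
  simp only [dynkinBCH_rat]
  exact bch_zero_right hc x

theorem dynkinBCH_neg_left {c : ℕ} (hc : LieModule.lowerCentralSeries ℤ L L c = ⊥) (x : L) : dynkinBCH K c (-x) x = 0 := by
  let _ := ratLieAlgebra K L
  simp only [dynkinBCH_rat]
  exact bch_neg_left hc x

end real
end BCHAux

namespace BCHAux

theorem nestedBracket_mem {K L : Type*} [Field K] [LieRing L] [LieAlgebra K L] (P : Submodule K L)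
    (hP : ∀ x ∈ P, ∀ y ∈ P, ⁅x, y⁆ ∈ P) (l : List L) (hl : ∀ w ∈ l, w ∈ P) :
    nestedBracket l ∈ P := by
  induction l with
  | nil => simp [nestedBracket]
  | cons x l ih =>
    rcases l with _ | ⟨y, l⟩
    · simpa [nestedBracket] using hl
    · exact hP _ (hl x (by simp)) _ (ih fun w hw => hl w (List.mem_cons_of_mem _ hw))

theorem dynkinBCH_mem {K L : Type*} [Field K] [LieRing L] [LieAlgebra K L] (P : Submodule K L)
    (hP : ∀ x ∈ P, ∀ y ∈ P, ⁅x, y⁆ ∈ P) (c : ℕ) {x y : L} (hx : x ∈ P) (hy : y ∈ P) :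
    dynkinBCH K c x y ∈ P := by
  refine Submodule.sum_mem _ fun k _ => Submodule.sum_mem _ fun p _ => Submodule.smul_mem _ _ ?_
  refine nestedBracket_mem P hP _ fun w hw => ?_
  rcases mem_of_mem_dynkinWord hw with rfl | rfl
  exacts [hx, hy]

/-- A linear form that vanishes on brackets is additive for the BCH product. -/
theorem apply_dynkinBCH {K L : Type*} [Field K] [LieRing L] [LieAlgebra K L] (P : Submodule K L)
    (hP : ∀ x ∈ P, ∀ y ∈ P, ⁅x, y⁆ ∈ P) (φ : L →ₗ[K] K)
    (hφ : ∀ x ∈ P, ∀ y ∈ P, φ ⁅x, y⁆ = 0) {c : ℕ}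
    (hc : LieModule.lowerCentralSeries ℤ L L c = ⊥) {x y : L} (hx : x ∈ P) (hy : y ∈ P) :
    φ (dynkinBCH K c x y) = φ x + φ y := by
  have hmem : ∀ {k : ℕ} (p : Fin k → ℕ × ℕ), ∀ w ∈ dynkinWord x y p, w ∈ P := by
    intro k p w hw
    rcases mem_of_mem_dynkinWord hw with rfl | rfl
    exacts [hx, hy]
  have hlong : ∀ l : List L, (∀ w ∈ l, w ∈ P) → l.length ≠ 1 → φ (nestedBracket l) = 0 := by
    intro l hl h1
    rcases l with _ | ⟨a, _ | ⟨b, l⟩⟩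
    · simp [nestedBracket]
    · simp at h1
    · exact hφ _ (hl a (by simp)) _ (nestedBracket_mem P hP _ fun w hw =>
        hl w (List.mem_cons_of_mem _ hw))
  rcases c with _ | c
  · have h0 : ∀ v : L, v = 0 := by
      intro v
      have : v ∈ LieModule.lowerCentralSeries ℤ L L 0 := by simp
      rw [hc] at this
      simpa using this
    rw [h0 x, h0 y, h0 (dynkinBCH K 0 _ _)]; simp
  · simp only [dynkinBCH, map_sum, map_smul]
    rw [Finset.sum_range_succ', Finset.sum_eq_zero, zero_add]
    · have hne : (fun _ : Fin (0 + 1) => ((1, 0) : ℕ × ℕ)) ≠ fun _ => (0, 1) := by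
        intro h; simpa using congrFun h 0
      rw [Finset.sum_eq_add (fun _ => (1, 0)) (fun _ => (0, 1)) hne]
      · simp [dynkinWord, nestedBracket]
      · intro p _ hp
        have : (dynkinWord x y p).length ≠ 1 := by
          rw [length_dynkinWord]
          intro h
          have hs : ∀ i : Fin (0 + 1), i = 0 := fun i => by ext; omega
          have hp0 : p = fun _ => p 0 := by
            funext i; rw [hs i]
          rw [Finset.sum_eq_single_of_mem 0 (Finset.mem_univ _)
            (fun i _ hi => absurd (hs i) hi)] at h
          rcases hq : p 0 with ⟨a, b⟩
          rw [hq] at hp0 h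
          obtain ⟨rfl, rfl⟩ | ⟨rfl, rfl⟩ : (a = 1 ∧ b = 0) ∨ (a = 0 ∧ b = 1) := by
            simp only at h; omega
          exacts [hp.1 hp0, hp.2 hp0]
        rw [hlong _ (hmem p) this, smul_zero]
      · intro h
        exact absurd (Fintype.mem_piFinset.mpr fun _ => by simp [dynkinPairs]) h
      · intro h
        exact absurd (Fintype.mem_piFinset.mpr fun _ => by simp [dynkinPairs]) h
    · intro k _
      refine Finset.sum_eq_zero fun p hp => ?_
      rw [hlong _ (hmem p), smul_zero]
      rw [length_dynkinWord]
      have h1 : ∀ i ∈ (Finset.univ : Finset (Fin (k + 1 + 1))), 1 ≤ (p i).1 + (p i).2 := by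
        intro i _
        have h0 := Fintype.mem_piFinset.mp hp i
        have h1 : p i ≠ (0, 0) := Finset.ne_of_mem_erase h0
        by_contra h
        exact h1 (by ext <;> simp <;> omega)
      have h2 := Finset.card_nsmul_le_sum _ _ _ h1
      simp at h2
      omega

section topology
variable {L : Type*} [LieRing L] [LieAlgebra ℝ L] [TopologicalSpace L] [IsTopologicalAddGroup L]
  [ContinuousSMul ℝ L] [T2Space L] [FiniteDimensional ℝ L]

theorem continuous_lie {X : Type*} [TopologicalSpace X] {f g : X → L} (hf : Continuous f)
    (hg : Continuous g) : Continuous fun x => ⁅f x, g x⁆ := by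
  set b := Module.finBasis ℝ L
  have h : (fun x => ⁅f x, g x⁆)
      = fun x => ∑ i, ∑ j, (b.coord i (f x) * b.coord j (g x)) • ⁅b i, b j⁆ := by
    funext x
    conv_lhs => rw [← b.sum_repr (f x), ← b.sum_repr (g x)]
    simp only [sum_lie, lie_sum, smul_lie, lie_smul, Module.Basis.coord_apply, Finset.smul_sum,
      smul_smul]
    rw [Finset.sum_comm]
    exact Finset.sum_congr rfl fun i _ => Finset.sum_congr rfl fun j _ => by rw [mul_comm]
  rw [h]
  refine continuous_finsetSum _ fun i _ => continuous_finsetSum _ fun j _ => ?_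
  refine Continuous.smul (Continuous.mul ?_ ?_) continuous_const
  · exact (b.coord i).continuous_of_finiteDimensional.comp hf
  · exact (b.coord j).continuous_of_finiteDimensional.comp hg

theorem continuous_nestedBracket {X ι : Type*} [TopologicalSpace X] (f : ι → X → L)
    (hf : ∀ i, Continuous (f i)) (l : List ι) :
    Continuous fun x => nestedBracket (l.map fun i => f i x) := by
  induction l with
  | nil => simpa [nestedBracket] using continuous_const
  | cons i l ih =>
    rcases l with _ | ⟨j, l⟩
    · simpa [nestedBracket] using hf i
    · exact continuous_lie (hf i) ih

theorem continuous_dynkinBCH {X : Type*} [TopologicalSpace X] (c : ℕ) {f g : X → L}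
    (hf : Continuous f) (hg : Continuous g) : Continuous fun x => dynkinBCH ℝ c (f x) (g x) := by
  refine continuous_finsetSum _ fun k _ => continuous_finsetSum _ fun p _ =>
    Continuous.const_smul ?_ _
  have h : ∀ x, dynkinWord (f x) (g x) p
      = (dynkinWord true false p).map fun i => (fun (i : Bool) x => if i then f x else g x) i x := by
    intro x; rw [map_dynkinWord]; simp
  simp only [h]
  refine continuous_nestedBracket (fun (i : Bool) x => if i then f x else g x) ?_ _
  rintro (_ | _)
  exacts [by simpa using hg, by simpa using hf]

end topology
end BCHAux

/-- The connected simply connected Lie group `G = exp 𝔤` of a finite dimensional real nilpotent Lie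
algebra `𝔤`. Its exponential map is a bijection, written as the constructor `ExpGroup.exp`, with
inverse `ExpGroup.log`; the product is `exp x · exp y = exp (BCH(x, y))`, and `G` carries the
topology of `𝔤` through `exp`. -/
@[ext]
structure ExpGroup (𝔤 : Type*) where
  /-- The exponential map. -/
  exp ::
  /-- The logarithm. -/
  log : 𝔤

namespace ExpGroup
open BCHAux

section group
variable {𝔤 : Type*} [LieRing 𝔤] [LieAlgebra ℝ 𝔤] [LieRing.IsNilpotent 𝔤]

theorem lcs_nilpotencyLength (L : Type*) [LieRing L] [LieRing.IsNilpotent L] :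
    LieModule.lowerCentralSeries ℤ L L (LieModule.nilpotencyLength L L) = ⊥ :=
  Nat.sInf_mem (s := {k | LieModule.lowerCentralSeries ℤ L L k = ⊥})
    (LieModule.IsNilpotent.nilpotent_int (L := L) (M := L))

noncomputable instance : Group (ExpGroup 𝔤) where
  mul u v := exp (dynkinBCH ℝ (LieModule.nilpotencyLength 𝔤 𝔤) u.log v.log)
  one := exp 0
  inv u := exp (-u.log)
  mul_assoc u v w := ExpGroup.ext (dynkinBCH_assoc (lcs_nilpotencyLength 𝔤) _ _ _)
  one_mul u := ExpGroup.ext (dynkinBCH_zero_left (lcs_nilpotencyLength 𝔤) _)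
  mul_one u := ExpGroup.ext (dynkinBCH_zero_right (lcs_nilpotencyLength 𝔤) _)
  inv_mul_cancel u := ExpGroup.ext (dynkinBCH_neg_left (lcs_nilpotencyLength 𝔤) _)

theorem log_mul (u v : ExpGroup 𝔤) :
    (u * v).log = dynkinBCH ℝ (LieModule.nilpotencyLength 𝔤 𝔤) u.log v.log := rfl

theorem log_inv (u : ExpGroup 𝔤) : (u⁻¹).log = -u.log := rfl

theorem log_one : (1 : ExpGroup 𝔤).log = 0 := rfl

instance [TopologicalSpace 𝔤] : TopologicalSpace (ExpGroup 𝔤) :=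
  TopologicalSpace.induced log inferInstance

instance [TopologicalSpace 𝔤] : MeasurableSpace (ExpGroup 𝔤) := borel _

instance [TopologicalSpace 𝔤] : BorelSpace (ExpGroup 𝔤) := ⟨rfl⟩

/-- The logarithm as a homeomorphism. -/
def logHomeomorph (𝔤 : Type*) [TopologicalSpace 𝔤] : ExpGroup 𝔤 ≃ₜ 𝔤 where
  toFun := log
  invFun := exp
  left_inv _ := rfl
  right_inv _ := rfl
  continuous_toFun := continuous_induced_dom
  continuous_invFun := continuous_induced_rng.mpr continuous_id

end group

section topology
variable {𝔤 : Type*} [TopologicalSpace 𝔤]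

theorem continuous_log : Continuous (log : ExpGroup 𝔤 → 𝔤) := continuous_induced_dom

theorem continuous_exp : Continuous (exp : 𝔤 → ExpGroup 𝔤) :=
  continuous_induced_rng.mpr continuous_id

instance [T2Space 𝔤] : T2Space (ExpGroup 𝔤) := (logHomeomorph 𝔤).symm.t2Space

variable [LieRing 𝔤] [LieAlgebra ℝ 𝔤] [IsTopologicalAddGroup 𝔤]
  [ContinuousSMul ℝ 𝔤] [T2Space 𝔤] [FiniteDimensional ℝ 𝔤]

instance : LocallyCompactSpace (ExpGroup 𝔤) :=
  ((logHomeomorph 𝔤).trans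
    (Module.finBasis ℝ 𝔤).equivFunL.toHomeomorph).isClosedEmbedding.locallyCompactSpace

instance : SecondCountableTopology (ExpGroup 𝔤) :=
  ((logHomeomorph 𝔤).trans
    (Module.finBasis ℝ 𝔤).equivFunL.toHomeomorph).secondCountableTopology

instance [LieRing.IsNilpotent 𝔤] : IsTopologicalGroup (ExpGroup 𝔤) where
  continuous_mul := continuous_induced_rng.mpr
    (continuous_dynkinBCH _ (continuous_log.comp continuous_fst)
      (continuous_log.comp continuous_snd))
  continuous_inv := continuous_induced_rng.mpr continuous_log.neg

end topology
end ExpGroup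

/-- A strongly continuous unitary representation of `G` on `H`. -/
structure UnitaryRep (G : Type*) [Group G] [TopologicalSpace G] (H : Type*)
    [NormedAddCommGroup H] [InnerProductSpace ℂ H] where
  toHom : G →* (H ≃ₗᵢ[ℂ] H)
  continuous_apply : ∀ ξ : H, Continuous fun g => toHom g ξ

/-- A Hilbert space together with a unitary representation of `G` on it. Cyclic representations of a
second countable locally compact group are separable, so the universe `Type` is large enough to
compute the norm of the group C*-algebra. -/
structure HilbertRep (G : Type*) [Group G] [TopologicalSpace G] where
  H : Type
  [normed : NormedAddCommGroup H]
  [inner : InnerProductSpace ℂ H]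
  [complete : CompleteSpace H]
  rep : UnitaryRep G H

attribute [instance] HilbertRep.normed HilbertRep.inner HilbertRep.complete

section cstar
variable {G : Type*} [Group G] [TopologicalSpace G] [IsTopologicalGroup G]
  [LocallyCompactSpace G] [SecondCountableTopology G] [MeasurableSpace G] [BorelSpace G]

namespace UnitaryRep
variable {H : Type*} [NormedAddCommGroup H] [InnerProductSpace ℂ H]

theorem integrable_smul (π : UnitaryRep G H) (F : MeasureTheory.Lp ℂ 1 (MeasureTheory.Measure.haar (G := G))) (ξ : H) :
    MeasureTheory.Integrable (fun g => F g • π.toHom g ξ) MeasureTheory.Measure.haar := by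
  refine (MeasureTheory.L1.integrable_coeFn F).smul_of_top_left ?_
  refine MeasureTheory.memLp_top_of_bound (π.continuous_apply ξ).aestronglyMeasurable ‖ξ‖ ?_
  exact Filter.Eventually.of_forall fun g => by simp

/-- The integrated form `π(F) ξ = ∫ F(g) π(g) ξ dg` of `π`, for `F ∈ L¹(G)`. -/
noncomputable def integrated (π : UnitaryRep G H)
    (F : MeasureTheory.Lp ℂ 1 (MeasureTheory.Measure.haar (G := G))) : H →L[ℂ] H :=
  LinearMap.mkContinuous
    { toFun := fun ξ => ∫ g, F g • π.toHom g ξ ∂MeasureTheory.Measure.haar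
      map_add' := fun ξ η => by
        simp only [map_add, smul_add]
        exact MeasureTheory.integral_add (π.integrable_smul F ξ) (π.integrable_smul F η)
      map_smul' := fun c ξ => by
        simp only [map_smul, RingHom.id_apply, smul_comm _ c]
        exact MeasureTheory.integral_smul c _ }
    ‖F‖ fun ξ => by
      refine (MeasureTheory.norm_integral_le_integral_norm _).trans (le_of_eq ?_)
      simp only [norm_smul, LinearIsometryEquiv.norm_map]
      rw [MeasureTheory.integral_mul_const, ← MeasureTheory.L1.norm_eq_integral_norm]

theorem norm_integrated_le (π : UnitaryRep G H)
    (F : MeasureTheory.Lp ℂ 1 (MeasureTheory.Measure.haar (G := G))) : ‖π.integrated F‖ ≤ ‖F‖ :=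
  LinearMap.mkContinuous_norm_le _ (norm_nonneg _) _

end UnitaryRep

variable (G) in
/-- The C*-algebra of bounded operator fields over all unitary representations of `G`. -/
abbrev OperatorFields : Type _ := lp (fun π : HilbertRep G => π.H →L[ℂ] π.H) ⊤

/-- The field `(π(F))_π` of the integrated forms of `F ∈ L¹(G)`, of norm `sup_π ‖π(F)‖`. -/
noncomputable def universalRep (F : MeasureTheory.Lp ℂ 1 (MeasureTheory.Measure.haar (G := G))) :
    OperatorFields G :=
  ⟨fun π => π.rep.integrated F, memℓp_infty ⟨‖F‖, by
    rintro _ ⟨π, rfl⟩; exact π.rep.norm_integrated_le F⟩⟩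

variable (G) in
/-- The group C*-algebra `C*(G)`: the C*-algebra generated by `L¹(G)` in its universal
representation, that is, the completion of `L¹(G)` for the norm `sup_π ‖π(F)‖`. -/
noncomputable def groupCStarAlgebra : NonUnitalStarSubalgebra ℂ (OperatorFields G) :=
  (NonUnitalStarAlgebra.adjoin ℂ (Set.range (universalRep (G := G)))).topologicalClosure

/-- `L¹(G) → C*(G)`. -/
noncomputable def groupCStarAlgebra.ofL1
    (F : MeasureTheory.Lp ℂ 1 (MeasureTheory.Measure.haar (G := G))) : groupCStarAlgebra G :=
  ⟨universalRep F, NonUnitalStarSubalgebra.le_topologicalClosure _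
    (NonUnitalStarAlgebra.subset_adjoin ℂ _ ⟨F, rfl⟩)⟩

/-- The extension `π : C*(G) → B(H)` of a unitary representation of `G`: the coordinate at `π`. -/
def UnitaryRep.onCStar {H : Type} [NormedAddCommGroup H] [InnerProductSpace ℂ H] [CompleteSpace H]
    (π : UnitaryRep G H) (a : groupCStarAlgebra G) : H →L[ℂ] H :=
  (a : OperatorFields G) ⟨H, π⟩

theorem UnitaryRep.onCStar_ofL1 {H : Type} [NormedAddCommGroup H] [InnerProductSpace ℂ H]
    [CompleteSpace H] (π : UnitaryRep G H)
    (F : MeasureTheory.Lp ℂ 1 (MeasureTheory.Measure.haar (G := G))) :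
    π.onCStar (groupCStarAlgebra.ofL1 F) = π.integrated F := rfl

end cstar

/-- The span of the vectors `Z_i` with `i ≥ j` (the indices start at `0`). -/
def tailSpan {𝔤 : Type*} [AddCommGroup 𝔤] [Module ℝ 𝔤] {n : ℕ} (Z : Fin n → 𝔤) (j : ℕ) :
    Submodule ℝ 𝔤 :=
  Submodule.span ℝ (Z '' {i | j ≤ (i : ℕ)})

/-- `Z₀, …, Z_{d+m-1}` is a basis of `𝔤`, its last `m` vectors span `𝔥`, and the span of
`Z_j, …, Z_{d+m-1}`, that is, of `Z_j, …, Z_{d-1}` and `𝔥`, is a subalgebra for every `j ≤ d`: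
a Malcev basis of `𝔤` (relative to, and passing through, `𝔥`). -/
structure IsMalcevBasis {𝔤 : Type*} [LieRing 𝔤] [LieAlgebra ℝ 𝔤] {d m : ℕ}
    (𝔥 : LieSubalgebra ℝ 𝔤) (Z : Fin (d + m) → 𝔤) : Prop where
  linearIndependent : LinearIndependent ℝ Z
  span_eq_top : Submodule.span ℝ (Set.range Z) = ⊤
  lie_mem : ∀ j ≤ d, ∀ x ∈ tailSpan Z j, ∀ y ∈ tailSpan Z j, ⁅x, y⁆ ∈ tailSpan Z j
  tailSpan_eq : tailSpan Z d = 𝔥.toSubmodule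

namespace ExpGroup
open BCHAux MeasureTheory

/-- A chain of subalgebras of codimension one with the data of coordinates of the second kind. -/
structure Chain (𝔤 : Type*) [LieRing 𝔤] [LieAlgebra ℝ 𝔤] (d : ℕ) where
  Z : ℕ → 𝔤
  c : ℕ → 𝔤 →ₗ[ℝ] ℝ
  P : ℕ → Submodule ℝ 𝔤
  Z_mem : ∀ j < d, Z j ∈ P j
  c_Z : ∀ j < d, c j (Z j) = 1
  mem_succ : ∀ j < d, ∀ x, x ∈ P (j + 1) ↔ x ∈ P j ∧ c j x = 0
  lie_mem : ∀ j ≤ d, ∀ x ∈ P j, ∀ y ∈ P j, ⁅x, y⁆ ∈ P j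
  c_lie : ∀ j < d, ∀ x ∈ P j, ∀ y ∈ P j, c j ⁅x, y⁆ = 0

namespace Chain
variable {𝔤 : Type*} [LieRing 𝔤] [LieAlgebra ℝ 𝔤] [LieRing.IsNilpotent 𝔤] {d : ℕ} (Γ : Chain 𝔤 d)

/-- Removal of the first factor. -/
noncomputable def strip (j : ℕ) (u : ExpGroup 𝔤) : ExpGroup 𝔤 :=
  exp (-(Γ.c j u.log • Γ.Z j)) * u

/-- The product of `l` exponentials, starting from index `j`. -/
noncomputable def prodExp (j : ℕ) : (l : ℕ) → (Fin l → ℝ) → ExpGroup 𝔤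
  | 0, _ => 1
  | l + 1, t => exp (t 0 • Γ.Z j) * prodExp (j + 1) l (Fin.tail t)

/-- The coordinates of the second kind. -/
noncomputable def coord (j : ℕ) : (l : ℕ) → ExpGroup 𝔤 → Fin l → ℝ
  | 0, _ => Fin.elim0
  | l + 1, u => Fin.cons (Γ.c j u.log) (coord (j + 1) l (Γ.strip j u))

/-- The component in the last subgroup of the chain. -/
noncomputable def res (j : ℕ) : (l : ℕ) → ExpGroup 𝔤 → ExpGroup 𝔤
  | 0, u => u
  | l + 1, u => res (j + 1) l (Γ.strip j u)

theorem mul_mem {j : ℕ} (hj : j ≤ d) {u v : ExpGroup 𝔤} (hu : u.log ∈ Γ.P j) (hv : v.log ∈ Γ.P j) :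
    (u * v).log ∈ Γ.P j :=
  dynkinBCH_mem _ (Γ.lie_mem j hj) _ hu hv

theorem c_mul {j : ℕ} (hj : j < d) {u v : ExpGroup 𝔤} (hu : u.log ∈ Γ.P j) (hv : v.log ∈ Γ.P j) :
    Γ.c j (u * v).log = Γ.c j u.log + Γ.c j v.log :=
  apply_dynkinBCH _ (Γ.lie_mem j hj.le) _ (Γ.c_lie j hj) (lcs_nilpotencyLength 𝔤) hu hv

theorem exp_smul_mem {j : ℕ} (hj : j < d) (a : ℝ) : (exp (a • Γ.Z j)).log ∈ Γ.P j :=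
  Submodule.smul_mem _ _ (Γ.Z_mem j hj)

theorem c_exp_smul {j : ℕ} (hj : j < d) (a : ℝ) : Γ.c j (exp (a • Γ.Z j)).log = a := by
  change Γ.c j (a • Γ.Z j) = a
  simp [Γ.c_Z j hj]

theorem strip_eq (j : ℕ) (u : ExpGroup 𝔤) : Γ.strip j u = (exp (Γ.c j u.log • Γ.Z j))⁻¹ * u := rfl

theorem strip_mem {j : ℕ} (hj : j < d) {u : ExpGroup 𝔤} (hu : u.log ∈ Γ.P j) :
    (Γ.strip j u).log ∈ Γ.P (j + 1) := by
  have h1 : (exp (-(Γ.c j u.log • Γ.Z j))).log ∈ Γ.P j :=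
    neg_mem (Γ.exp_smul_mem hj _)
  refine (Γ.mem_succ j hj _).mpr ⟨Γ.mul_mem hj.le h1 hu, ?_⟩
  rw [strip, Γ.c_mul hj h1 hu]
  change Γ.c j (-(Γ.c j u.log • Γ.Z j)) + _ = 0
  simp [Γ.c_Z j hj]

theorem prodExp_mem (l : ℕ) : ∀ j, j + l ≤ d → ∀ t, (Γ.prodExp j l t).log ∈ Γ.P j := by
  induction l with
  | zero => intro j _ t; exact zero_mem _
  | succ l ih =>
    intro j hj t
    exact Γ.mul_mem (by omega) (Γ.exp_smul_mem (by omega) _)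
      (((Γ.mem_succ j (by omega) _).mp (ih (j + 1) (by omega) _)).1)

theorem le_of_le {j l : ℕ} (h : j + l ≤ d) : Γ.P (j + l) ≤ Γ.P j := by
  induction l with
  | zero => exact le_rfl
  | succ l ih =>
    intro x hx
    exact ih (by omega) ((Γ.mem_succ (j + l) (by omega) x).mp hx).1

theorem prodExp_coord_mul_res (l : ℕ) : ∀ j, j + l ≤ d → ∀ u : ExpGroup 𝔤, u.log ∈ Γ.P j →
    Γ.prodExp j l (Γ.coord j l u) * Γ.res j l u = u ∧ (Γ.res j l u).log ∈ Γ.P (j + l) := by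
  induction l with
  | zero => intro j _ u hu; exact ⟨one_mul u, hu⟩
  | succ l ih =>
    intro j hj u hu
    obtain ⟨h1, h2⟩ := ih (j + 1) (by omega) (Γ.strip j u) (Γ.strip_mem (by omega) hu)
    refine ⟨?_, by rw [show j + (l + 1) = j + 1 + l by omega]; exact h2⟩
    rw [prodExp, coord, res, Fin.tail_cons, Fin.cons_zero, mul_assoc, h1, strip_eq,
      mul_inv_cancel_left]

theorem c_of_exp_mul {j : ℕ} (hj : j < d) (a : ℝ) {w : ExpGroup 𝔤} (hw : w.log ∈ Γ.P (j + 1)) :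
    Γ.c j (exp (a • Γ.Z j) * w).log = a := by
  obtain ⟨h1, h2⟩ := (Γ.mem_succ j hj _).mp hw
  rw [Γ.c_mul hj (Γ.exp_smul_mem hj a) h1, h2, add_zero, Γ.c_exp_smul hj]

theorem coord_prodExp_mul (l : ℕ) : ∀ j, j + l ≤ d → ∀ (t : Fin l → ℝ) (h : ExpGroup 𝔤),
    h.log ∈ Γ.P (j + l) →
    Γ.coord j l (Γ.prodExp j l t * h) = t ∧ Γ.res j l (Γ.prodExp j l t * h) = h := by
  induction l with
  | zero => intro j _ t h hh; exact ⟨Subsingleton.elim _ _, one_mul h⟩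
  | succ l ih =>
    intro j hj t h hh
    have hh' : h.log ∈ Γ.P (j + 1 + l) := by rwa [show j + 1 + l = j + (l + 1) by omega]
    obtain ⟨h1, h2⟩ := ih (j + 1) (by omega) (Fin.tail t) h hh'
    have hw : (Γ.prodExp (j + 1) l (Fin.tail t) * h).log ∈ Γ.P (j + 1) :=
      Γ.mul_mem (by omega) (Γ.prodExp_mem l (j + 1) (by omega) _) (Γ.le_of_le (by omega) hh')
    have hc : Γ.c j (Γ.prodExp j (l + 1) t * h).log = t 0 := by
      rw [prodExp, mul_assoc]; exact Γ.c_of_exp_mul (by omega) _ hw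
    have hs : Γ.strip j (Γ.prodExp j (l + 1) t * h) = Γ.prodExp (j + 1) l (Fin.tail t) * h := by
      rw [strip_eq, hc, prodExp, mul_assoc, inv_mul_cancel_left]
    rw [coord, res, hc, hs, h1, h2]
    exact ⟨Fin.cons_self_tail t, rfl⟩

section top
variable [TopologicalSpace 𝔤] [IsTopologicalAddGroup 𝔤]
  [ContinuousSMul ℝ 𝔤] [T2Space 𝔤] [FiniteDimensional ℝ 𝔤]

theorem continuous_c (j : ℕ) : Continuous fun u : ExpGroup 𝔤 => Γ.c j u.log :=
  (Γ.c j).continuous_of_finiteDimensional.comp continuous_log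

theorem continuous_strip (j : ℕ) : Continuous (Γ.strip j) :=
  (continuous_exp.comp ((Γ.continuous_c j).smul continuous_const).neg).mul continuous_id

theorem continuous_prodExp (l : ℕ) : ∀ j, Continuous (Γ.prodExp j l) := by
  induction l with
  | zero => intro j; exact continuous_const
  | succ l ih =>
    intro j
    exact (continuous_exp.comp ((continuous_apply 0).smul continuous_const)).mul
      ((ih (j + 1)).comp (continuous_pi fun i => continuous_apply (Fin.succ i)))

theorem continuous_coord (l : ℕ) : ∀ j, Continuous (Γ.coord j l) := by
  induction l with
  | zero => intro j; exact continuous_of_const fun _ _ => Subsingleton.elim _ _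
  | succ l ih =>
    intro j
    refine continuous_pi fun i => ?_
    refine Fin.cases ?_ (fun i => ?_) i
    · exact Γ.continuous_c j
    · exact (continuous_apply i).comp ((ih (j + 1)).comp (Γ.continuous_strip j))

theorem continuous_res (l : ℕ) : ∀ j, Continuous (Γ.res j l) := by
  induction l with
  | zero => intro j; exact continuous_id
  | succ l ih => intro j; exact (ih (j + 1)).comp (Γ.continuous_strip j)

/-- The invariant measure on `G/H`. -/
theorem measurePreserving (l : ℕ) : ∀ j, j + l ≤ d → ∀ g : ExpGroup 𝔤, g.log ∈ Γ.P j →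
    MeasurePreserving (fun t => Γ.coord j l (g * Γ.prodExp j l t)) volume volume := by
  induction l with
  | zero =>
    intro j _ g _
    have : (fun t => Γ.coord j 0 (g * Γ.prodExp j 0 t)) = id := by
      funext t; exact Subsingleton.elim _ _
    rw [this]; exact MeasurePreserving.id _
  | succ l ih =>
    intro j hj g hg
    have hj' : j < d := by omega
    set a := Γ.c j g.log
    let n : ℝ → ExpGroup 𝔤 := fun s => Γ.strip j (g * exp (s • Γ.Z j))
    have hn : ∀ s, (n s).log ∈ Γ.P (j + 1) := fun s =>
      Γ.strip_mem hj' (Γ.mul_mem hj'.le hg (Γ.exp_smul_mem hj' s))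
    have hnc : Continuous n := (Γ.continuous_strip j).comp
      (continuous_const.mul (continuous_exp.comp (continuous_id.smul continuous_const)))
    have key : ∀ t : Fin (l + 1) → ℝ, Γ.coord j (l + 1) (g * Γ.prodExp j (l + 1) t)
        = Fin.cons (t 0 + a) (Γ.coord (j + 1) l (n (t 0) * Γ.prodExp (j + 1) l (Fin.tail t))) := by
      intro t
      have hE := Γ.prodExp_mem l (j + 1) (by omega) (Fin.tail t)
      have hE' := (Γ.mem_succ j hj' _).mp hE
      have h1 : Γ.c j (g * exp (t 0 • Γ.Z j)).log = t 0 + a := by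
        rw [Γ.c_mul hj' hg (Γ.exp_smul_mem hj' _), Γ.c_exp_smul hj', add_comm]
      have h2 : Γ.c j (g * Γ.prodExp j (l + 1) t).log = t 0 + a := by
        rw [prodExp, ← mul_assoc, Γ.c_mul hj' (Γ.mul_mem hj'.le hg (Γ.exp_smul_mem hj' _)) hE'.1,
          hE'.2, add_zero, h1]
      have h3 : Γ.strip j (g * Γ.prodExp j (l + 1) t)
          = n (t 0) * Γ.prodExp (j + 1) l (Fin.tail t) := by
        change _ = Γ.strip j (g * exp (t 0 • Γ.Z j)) * _
        rw [strip_eq, strip_eq, h2, h1, prodExp]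
        simp only [mul_assoc]
      rw [coord, h2, h3]
    have hskew : MeasurePreserving (fun p : ℝ × (Fin l → ℝ) =>
        (p.1 + a, Γ.coord (j + 1) l (n p.1 * Γ.prodExp (j + 1) l p.2)))
        (volume.prod volume) (volume.prod volume) := by
      refine (measurePreserving_add_right volume a).skew_product
        (g := fun s t => Γ.coord (j + 1) l (n s * Γ.prodExp (j + 1) l t)) ?_ ?_
      · refine Continuous.measurable ?_
        exact (Γ.continuous_coord l (j + 1)).comp
          ((hnc.comp continuous_fst).mul ((Γ.continuous_prodExp l (j + 1)).comp continuous_snd))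
      · exact Filter.Eventually.of_forall fun s => (ih (j + 1) (by omega) (n s) (hn s)).map_eq
    have he := volume_preserving_piFinSuccAbove (fun _ : Fin (l + 1) => ℝ) 0
    have hcomp := (he.symm _).comp (hskew.comp he)
    have hf : ∀ {f g : (Fin (l + 1) → ℝ) → (Fin (l + 1) → ℝ)}, MeasurePreserving f volume volume →
        g = f → MeasurePreserving g volume volume := fun h e => e ▸ h
    refine hf hcomp ?_
    funext t
    rw [key]
    simp only [Function.comp_apply]
    rw [MeasurableEquiv.eq_symm_apply]
    simp [MeasurableEquiv.piFinSuccAbove, Fin.insertNthEquiv, Fin.removeNth, Fin.tail_def]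
end top
end Chain
end ExpGroup

namespace TwistedComp
open MeasureTheory Filter Topology

variable {X : Type*} [MeasurableSpace X] {μ : Measure X}

theorem memLp_mul {θ : X → ℂ} (hθ : AEStronglyMeasurable θ μ) (h1 : ∀ x, ‖θ x‖ = 1) {f : X → ℂ}
    (hf : MemLp f 2 μ) : MemLp (fun x => θ x * f x) 2 μ :=
  hf.of_le (hθ.mul hf.1) (Eventually.of_forall fun x => by simp [h1])

/-- Multiplication by a function of modulus one. -/
noncomputable def mulU (θ : X → ℂ) (hθ : AEStronglyMeasurable θ μ) (h1 : ∀ x, ‖θ x‖ = 1) :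
    Lp ℂ 2 μ →ₗᵢ[ℂ] Lp ℂ 2 μ where
  toFun f := (memLp_mul hθ h1 (Lp.memLp f)).toLp _
  map_add' f g := by
    ext1
    filter_upwards [MemLp.coeFn_toLp (memLp_mul hθ h1 (Lp.memLp (f + g))),
      Lp.coeFn_add f g, Lp.coeFn_add ((memLp_mul hθ h1 (Lp.memLp f)).toLp _)
        ((memLp_mul hθ h1 (Lp.memLp g)).toLp _),
      MemLp.coeFn_toLp (memLp_mul hθ h1 (Lp.memLp f)),
      MemLp.coeFn_toLp (memLp_mul hθ h1 (Lp.memLp g))] with x h1 h2 h3 h4 h5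
    rw [h1, h2, h3, Pi.add_apply, Pi.add_apply, h4, h5, mul_add]
  map_smul' c f := by
    ext1
    filter_upwards [MemLp.coeFn_toLp (memLp_mul hθ h1 (Lp.memLp (c • f))),
      Lp.coeFn_smul c f, Lp.coeFn_smul c ((memLp_mul hθ h1 (Lp.memLp f)).toLp _),
      MemLp.coeFn_toLp (memLp_mul hθ h1 (Lp.memLp f))] with x h1 h2 h3 h4
    simp only [RingHom.id_apply]
    rw [h1, h2, h3, Pi.smul_apply, Pi.smul_apply, h4, smul_eq_mul, smul_eq_mul]
    ring
  norm_map' f := by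
    change ‖(memLp_mul hθ h1 (Lp.memLp f)).toLp _‖ = ‖f‖
    rw [Lp.norm_toLp, Lp.norm_def]
    congr 1
    exact eLpNorm_congr_norm_ae (Eventually.of_forall fun x => by simp [h1])

theorem mulU_ae (θ : X → ℂ) (hθ : AEStronglyMeasurable θ μ) (h1 : ∀ x, ‖θ x‖ = 1) (f : Lp ℂ 2 μ) :
    mulU θ hθ h1 f =ᵐ[μ] fun x => θ x * f x :=
  MemLp.coeFn_toLp (memLp_mul hθ h1 (Lp.memLp f))

/-- `ξ ↦ θ · (ξ ∘ φ)`. -/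
noncomputable def twist (θ : X → ℂ) (hθ : AEStronglyMeasurable θ μ) (h1 : ∀ x, ‖θ x‖ = 1)
    (φ : X → X) (hφ : MeasurePreserving φ μ μ) : Lp ℂ 2 μ →ₗᵢ[ℂ] Lp ℂ 2 μ :=
  (mulU θ hθ h1).comp (Lp.compMeasurePreservingₗᵢ ℂ φ hφ)

theorem twist_ae (θ : X → ℂ) (hθ : AEStronglyMeasurable θ μ) (h1 : ∀ x, ‖θ x‖ = 1)
    (φ : X → X) (hφ : MeasurePreserving φ μ μ) (f : Lp ℂ 2 μ) :
    twist θ hθ h1 φ hφ f =ᵐ[μ] fun x => θ x * f (φ x) := by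
  filter_upwards [mulU_ae θ hθ h1 (Lp.compMeasurePreservingₗᵢ ℂ φ hφ f),
    Lp.coeFn_compMeasurePreserving f hφ] with x hx hx2
  have : twist θ hθ h1 φ hφ f = mulU θ hθ h1 (Lp.compMeasurePreservingₗᵢ ℂ φ hφ f) := rfl
  rw [this, hx]
  congr 1

theorem continuous_mulU {A : Type*} [TopologicalSpace A] [FirstCountableTopology A]
    (θ : A → X → ℂ) (hθ : ∀ a, AEStronglyMeasurable (θ a) μ) (h1 : ∀ a x, ‖θ a x‖ = 1)
    (hc : ∀ x, Continuous fun a => θ a x) (f : Lp ℂ 2 μ) :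
    Continuous fun a => mulU (θ a) (hθ a) (h1 a) f := by
  rw [continuous_iff_continuousAt]
  intro a₀
  refine (Lp.tendsto_Lp_iff_tendsto_eLpNorm'' (fun a x => θ a x * f x)
    (fun a => memLp_mul (hθ a) (h1 a) (Lp.memLp f)) (fun x => θ a₀ x * f x)
    (memLp_mul (hθ a₀) (h1 a₀) (Lp.memLp f))).mpr ?_
  have h2 : (2 : ENNReal) ≠ 0 := by norm_num
  have h2' : (2 : ENNReal) ≠ ⊤ := by norm_num
  simp only [eLpNorm_eq_lintegral_rpow_enorm_toReal h2 h2']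
  have hfin : ∫⁻ x, (2 * ‖f x‖ₑ) ^ (2 : ENNReal).toReal ∂μ ≠ ⊤ := by
    have := lintegral_rpow_enorm_lt_top_of_eLpNorm_lt_top h2 h2' (Lp.memLp f).2
    simp only [ENNReal.mul_rpow_of_nonneg _ _ ENNReal.toReal_nonneg]
    rw [lintegral_const_mul' _ _ (by norm_num)]
    exact ENNReal.mul_ne_top (by norm_num) this.ne
  have hlim : Tendsto (fun a => ∫⁻ x, ‖((fun x => θ a x * f x) - fun x => θ a₀ x * f x) x‖ₑ
      ^ (2 : ENNReal).toReal ∂μ) (𝓝 a₀) (𝓝 (∫⁻ _, 0 ∂μ)) := by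
    refine tendsto_lintegral_filter_of_dominated_convergence' _ ?_ ?_ hfin ?_
    · refine Eventually.of_forall fun a => ?_
      refine AEMeasurable.pow_const ?_ _
      exact (((hθ a).mul (Lp.aestronglyMeasurable f)).sub
        ((hθ a₀).mul (Lp.aestronglyMeasurable f))).enorm
    · refine Eventually.of_forall fun a => Eventually.of_forall fun x => ?_
      refine ENNReal.rpow_le_rpow ?_ ENNReal.toReal_nonneg
      simp only [Pi.sub_apply, ← sub_mul, enorm_mul]
      gcongr
      refine (enorm_sub_le).trans ?_
      rw [← ofReal_norm, ← ofReal_norm, h1, h1]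
      norm_num
    · refine Eventually.of_forall fun x => ?_
      have : Continuous fun a => ‖((fun x => θ a x * f x) - fun x => θ a₀ x * f x) x‖ₑ
          ^ (2 : ENNReal).toReal := by
        refine (ENNReal.continuous_rpow_const).comp (Continuous.enorm ?_)
        exact ((hc x).mul continuous_const).sub continuous_const
      have h := this.tendsto a₀
      simpa using h
  have h3 := ((ENNReal.continuous_rpow_const (y := 1 / (2 : ENNReal).toReal)).tendsto _).comp hlim
  simpa [Function.comp_def] using h3

end TwistedComp

namespace IsMalcevBasis
open ExpGroup BCHAux MeasureTheory

section
variable {𝔤 : Type*} [LieRing 𝔤] [LieAlgebra ℝ 𝔤] {d m : ℕ}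
  {𝔥 : LieSubalgebra ℝ 𝔤} {Z : Fin (d + m) → 𝔤} (hZ : IsMalcevBasis 𝔥 Z)

/-- The basis. -/
noncomputable def basis : Module.Basis (Fin (d + m)) ℝ 𝔤 :=
  Module.Basis.mk hZ.linearIndependent hZ.span_eq_top.ge

theorem basis_apply (i : Fin (d + m)) : hZ.basis i = Z i := by simp [basis]

theorem mem_tailSpan (hZ : IsMalcevBasis 𝔥 Z) (j : ℕ) (x : 𝔤) :
    x ∈ tailSpan Z j ↔ ∀ i : Fin (d + m), (i : ℕ) < j → hZ.basis.coord i x = 0 := by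
  have h : tailSpan Z j = Submodule.span ℝ (hZ.basis '' {i | j ≤ (i : ℕ)}) := by
    rw [tailSpan]; congr 2; funext i; exact (hZ.basis_apply i).symm
  rw [h, Module.Basis.mem_span_image]
  constructor
  · intro h i hi
    by_contra h0
    have := h (Finsupp.mem_support_iff.mpr h0)
    simp only [Set.mem_ofPred_eq] at this
    omega
  · intro h i hi
    by_contra h0
    simp only [Set.mem_ofPred_eq, not_le] at h0
    exact Finsupp.mem_support_iff.mp hi (h i h0)

theorem coord_lie [LieRing.IsNilpotent 𝔤] (i : Fin d) {x y : 𝔤} (hx : x ∈ tailSpan Z i)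
    (hy : y ∈ tailSpan Z i) : hZ.basis.coord (Fin.castAdd m i) ⁅x, y⁆ = 0 := by
  set c := hZ.basis.coord (Fin.castAdd m i) with hc
  set W := Z (Fin.castAdd m i) with hW
  have hcW : c W = 1 := by
    rw [hW, ← hZ.basis_apply, hc]; simp
  have hWm : W ∈ tailSpan Z i :=
    Submodule.subset_span ⟨Fin.castAdd m i, by simp, rfl⟩
  have hsucc : ∀ x, x ∈ tailSpan Z (i + 1) ↔ x ∈ tailSpan Z i ∧ c x = 0 := by
    intro x
    rw [hZ.mem_tailSpan, hZ.mem_tailSpan]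
    constructor
    · intro h
      exact ⟨fun k hk => h k (by omega), h _ (by simp)⟩
    · rintro ⟨h1, h2⟩ k hk
      rcases Nat.lt_succ_iff_lt_or_eq.mp hk with h | h
      · exact h1 k h
      · have : k = Fin.castAdd m i := by ext; simpa using h
        rw [this]; exact h2
  have hdec : ∀ v ∈ tailSpan Z i, v - c v • W ∈ tailSpan Z (i + 1) := by
    intro v hv
    refine (hsucc _).mpr ⟨sub_mem hv (Submodule.smul_mem _ _ hWm), ?_⟩
    simp [hcW]
  have hsub : ∀ x ∈ tailSpan Z (i + 1), ∀ y ∈ tailSpan Z (i + 1), c ⁅x, y⁆ = 0 := by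
    intro x hx y hy
    exact ((hsucc _).mp (hZ.lie_mem _ (by omega) x hx y hy)).2
  have hscal : ∀ w ∈ tailSpan Z (i + 1), ∀ v ∈ tailSpan Z i, c ⁅w, v⁆ = c ⁅w, W⁆ * c v := by
    intro w hw v hv
    have := hsub w hw _ (hdec v hv)
    rw [lie_sub, map_sub, lie_smul, map_smul, sub_eq_zero, smul_eq_mul] at this
    rw [this, mul_comm]
  have hzero : ∀ w ∈ tailSpan Z (i + 1), c ⁅w, W⁆ = 0 := by
    intro w hw
    have hwm := ((hsucc _).mp hw).1
    have hit : ∀ k : ℕ, (LieModule.toEnd ℝ 𝔤 𝔤 w)^[k] W ∈ tailSpan Z i ∧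
        c ((LieModule.toEnd ℝ 𝔤 𝔤 w)^[k] W) = c ⁅w, W⁆ ^ k := by
      intro k
      induction k with
      | zero => exact ⟨hWm, by simp [hcW]⟩
      | succ k ih =>
        rw [Function.iterate_succ_apply', LieModule.toEnd_apply_apply]
        refine ⟨hZ.lie_mem _ (by omega) _ hwm _ ih.1, ?_⟩
        rw [hscal w hw _ ih.1, ih.2, pow_succ']
    obtain ⟨k, hk⟩ := LieModule.IsNilpotent.nilpotent ℝ 𝔤 𝔤
    have h1 := LieModule.iterate_toEnd_mem_lowerCentralSeries ℝ 𝔤 𝔤 w W k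
    rw [hk, LieSubmodule.mem_bot] at h1
    have h2 := (hit k).2
    rw [h1, map_zero] at h2
    exact eq_zero_of_pow_eq_zero h2.symm
  have hx' := hdec x hx
  have hy' := hdec y hy
  have e1 : ⁅x, y⁆ = ⁅x - c x • W, y⁆ - c x • ⁅y - c y • W, W⁆ := by
    rw [sub_lie, smul_lie, sub_lie, smul_lie, lie_self, smul_zero, sub_zero, ← lie_skew y W,
      smul_neg]
    abel
  rw [e1, map_sub, map_smul, hzero _ hy', hscal _ hx' _ hy, hzero _ hx']
  simp

/-- The chain of subalgebras of a Malcev basis. -/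
noncomputable def chain [LieRing.IsNilpotent 𝔤] : Chain 𝔤 d where
  Z j := if h : j < d then Z (Fin.castAdd m ⟨j, h⟩) else 0
  c j := if h : j < d then hZ.basis.coord (Fin.castAdd m ⟨j, h⟩) else 0
  P j := tailSpan Z j
  Z_mem j hj := by
    rw [dif_pos hj]; exact Submodule.subset_span ⟨_, by simp, rfl⟩
  c_Z j hj := by
    rw [dif_pos hj, dif_pos hj, ← hZ.basis_apply]; simp
  mem_succ j hj x := by
    rw [dif_pos hj, hZ.mem_tailSpan, hZ.mem_tailSpan]
    constructor
    · intro h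
      exact ⟨fun k hk => h k (by omega), h _ (by simp)⟩
    · rintro ⟨h1, h2⟩ k hk
      rcases Nat.lt_succ_iff_lt_or_eq.mp hk with h | h
      · exact h1 k h
      · have : k = Fin.castAdd m ⟨j, hj⟩ := by ext; simpa using h
        rw [this]; exact h2
  lie_mem := hZ.lie_mem
  c_lie j hj x hx y hy := by
    rw [dif_pos hj]; exact hZ.coord_lie ⟨j, hj⟩ hx hy

end
end IsMalcevBasis

namespace ExpGroup
open MeasureTheory

/-- `E(t) = exp (t₀ Z₀) ⋯ exp (t_{d-1} Z_{d-1})`. -/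
noncomputable def malcevProd {𝔤 : Type*} [LieRing 𝔤] [LieAlgebra ℝ 𝔤] [LieRing.IsNilpotent 𝔤]
    {d m : ℕ} (Z : Fin (d + m) → 𝔤) (t : Fin d → ℝ) : ExpGroup 𝔤 :=
  (List.ofFn fun i : Fin d => exp (t i • Z (Fin.castAdd m i))).prod

/-- The character `χ_ℓ(h) = e^{-2πi⟨ℓ, log h⟩}`. -/
noncomputable def character {𝔤 : Type*} [AddCommGroup 𝔤] [Module ℝ 𝔤] (ℓ : 𝔤 →ₗ[ℝ] ℝ)
    (h : ExpGroup 𝔤) : ℂ :=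
  Complex.exp (-(2 * Real.pi * Complex.I * ℓ h.log))

variable {𝔤 : Type*} [LieRing 𝔤] [LieAlgebra ℝ 𝔤] [LieRing.IsNilpotent 𝔤] {d m : ℕ}
  {𝔥 : LieSubalgebra ℝ 𝔤} {Z : Fin (d + m) → 𝔤} (hZ : IsMalcevBasis 𝔥 Z) (ℓ : 𝔤 →ₗ[ℝ] ℝ)

theorem norm_character (h : ExpGroup 𝔤) : ‖character ℓ h‖ = 1 := by
  have : -(2 * Real.pi * Complex.I * ℓ h.log) = ((-(2 * Real.pi * ℓ h.log) : ℝ) : ℂ) * Complex.I := by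
    push_cast; ring
  rw [character, this, Complex.norm_exp_ofReal_mul_I]

theorem character_mul (hℓ : ∀ x ∈ 𝔥, ∀ y ∈ 𝔥, ℓ ⁅x, y⁆ = 0) {h k : ExpGroup 𝔤}
    (hh : h.log ∈ 𝔥) (hk : k.log ∈ 𝔥) : character ℓ (h * k) = character ℓ h * character ℓ k := by
  have : ℓ (h * k).log = ℓ h.log + ℓ k.log :=
    BCHAux.apply_dynkinBCH 𝔥.toSubmodule (fun x hx y hy => 𝔥.lie_mem hx hy) ℓ hℓ
      (lcs_nilpotencyLength 𝔤) hh hk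
  rw [character, character, character, this, ← Complex.exp_add]
  congr 1; push_cast; ring

theorem chain_prodExp (l : ℕ) : ∀ j (h : j + l = d) (t : Fin l → ℝ), hZ.chain.prodExp j l t
    = (List.ofFn fun i : Fin l => exp (t i • Z (Fin.castAdd m ⟨j + i, by omega⟩))).prod := by
  induction l with
  | zero => intro j h t; rfl
  | succ l ih =>
    intro j h t
    have hj : j < d := by omega
    rw [Chain.prodExp, ih (j + 1) (by omega), List.ofFn_succ, List.prod_cons]
    congr 1
    · simp [IsMalcevBasis.chain, hj]
    · congr 2
      funext i
      simp only [Fin.tail, Fin.val_succ]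
      rw [show (⟨j + 1 + (i : ℕ), by omega⟩ : Fin d) = ⟨j + ((i : ℕ) + 1), by omega⟩ from
        Fin.ext (by simp only; omega)]

theorem malcevProd_eq (t : Fin d → ℝ) : malcevProd Z t = hZ.chain.prodExp 0 d t := by
  rw [chain_prodExp hZ d 0 (by omega)]
  simp [malcevProd]

end ExpGroup

namespace IsMalcevBasis
open ExpGroup MeasureTheory
variable {𝔤 : Type*} [LieRing 𝔤] [LieAlgebra ℝ 𝔤] [LieRing.IsNilpotent 𝔤] {d m : ℕ}
  {𝔥 : LieSubalgebra ℝ 𝔤} {Z : Fin (d + m) → 𝔤} (hZ : IsMalcevBasis 𝔥 Z)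

/-- The coordinates `t ∈ ℝᵈ` of `u = E(t) h`, `h ∈ H = exp 𝔥`. -/
noncomputable def coord (u : ExpGroup 𝔤) : Fin d → ℝ := hZ.chain.coord 0 d u

/-- The component `h ∈ H = exp 𝔥` of `u = E(t) h`. -/
noncomputable def res (u : ExpGroup 𝔤) : ExpGroup 𝔤 := hZ.chain.res 0 d u

theorem tailSpan_zero (hZ : IsMalcevBasis 𝔥 Z) (x : 𝔤) : x ∈ tailSpan Z 0 := by
  rw [hZ.mem_tailSpan]; intro i hi; omega

theorem res_mem (u : ExpGroup 𝔤) : (hZ.res u).log ∈ 𝔥 := by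
  have h := (hZ.chain.prodExp_coord_mul_res d 0 (by omega) u (hZ.tailSpan_zero _)).2
  rw [zero_add] at h
  have h2 : (hZ.res u).log ∈ tailSpan Z d := h
  rwa [hZ.tailSpan_eq] at h2

theorem inv_res_mem (u : ExpGroup 𝔤) : ((hZ.res u)⁻¹).log ∈ 𝔥 := neg_mem (hZ.res_mem u)

theorem malcevProd_coord_mul_res (u : ExpGroup 𝔤) :
    malcevProd Z (hZ.coord u) * hZ.res u = u := by
  rw [malcevProd_eq hZ]
  exact (hZ.chain.prodExp_coord_mul_res d 0 (by omega) u (hZ.tailSpan_zero _)).1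

theorem mem_P {h : ExpGroup 𝔤} (hh : h.log ∈ 𝔥) : h.log ∈ hZ.chain.P (0 + d) := by
  rw [zero_add]
  change h.log ∈ tailSpan Z d
  rwa [hZ.tailSpan_eq]

theorem coord_malcevProd_mul (t : Fin d → ℝ) {h : ExpGroup 𝔤} (hh : h.log ∈ 𝔥) :
    hZ.coord (malcevProd Z t * h) = t := by
  rw [malcevProd_eq hZ]
  exact (hZ.chain.coord_prodExp_mul d 0 (by omega) t h (hZ.mem_P hh)).1

theorem res_malcevProd_mul (t : Fin d → ℝ) {h : ExpGroup 𝔤} (hh : h.log ∈ 𝔥) :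
    hZ.res (malcevProd Z t * h) = h := by
  rw [malcevProd_eq hZ]
  exact (hZ.chain.coord_prodExp_mul d 0 (by omega) t h (hZ.mem_P hh)).2

theorem coord_mul (u : ExpGroup 𝔤) (g : ExpGroup 𝔤) :
    hZ.coord (g * u) = hZ.coord (g * malcevProd Z (hZ.coord u)) ∧
    hZ.res (g * u) = hZ.res (g * malcevProd Z (hZ.coord u)) * hZ.res u := by
  set v := g * malcevProd Z (hZ.coord u) with hv
  have h1 : g * u = malcevProd Z (hZ.coord v) * (hZ.res v * hZ.res u) := by
    rw [← mul_assoc, hZ.malcevProd_coord_mul_res v, hv, mul_assoc, hZ.malcevProd_coord_mul_res u]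
  have hm : (hZ.res v * hZ.res u).log ∈ 𝔥 :=
    BCHAux.dynkinBCH_mem 𝔥.toSubmodule (fun x hx y hy => 𝔥.lie_mem hx hy) _ (hZ.res_mem v)
      (hZ.res_mem u)
  rw [h1]
  exact ⟨hZ.coord_malcevProd_mul _ hm, hZ.res_malcevProd_mul _ hm⟩

/-- The function `ξ̃` on `G` with `ξ̃(E(t) h) = χ_ℓ(h⁻¹) ξ(t)`, `h ∈ H`: the element of `L²(G/H, ℓ)`
that corresponds to `ξ ∈ L²(ℝᵈ)`. -/
noncomputable def covariantExtension (ℓ : 𝔤 →ₗ[ℝ] ℝ) (ξ : (Fin d → ℝ) → ℂ) (u : ExpGroup 𝔤) : ℂ :=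
  character ℓ (hZ.res u)⁻¹ * ξ (hZ.coord u)

theorem covariantExtension_apply (ℓ : 𝔤 →ₗ[ℝ] ℝ) (ξ : (Fin d → ℝ) → ℂ) (t : Fin d → ℝ)
    {h : ExpGroup 𝔤} (hh : h.log ∈ 𝔥) :
    hZ.covariantExtension ℓ ξ (malcevProd Z t * h) = character ℓ h⁻¹ * ξ t := by
  rw [covariantExtension, hZ.coord_malcevProd_mul t hh, hZ.res_malcevProd_mul t hh]

variable [TopologicalSpace 𝔤] [IsTopologicalAddGroup 𝔤]
  [ContinuousSMul ℝ 𝔤] [T2Space 𝔤] [FiniteDimensional ℝ 𝔤] (ℓ : 𝔤 →ₗ[ℝ] ℝ)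

theorem continuous_malcevProd (hZ : IsMalcevBasis 𝔥 Z) : Continuous (malcevProd Z) := by
  have : malcevProd Z = hZ.chain.prodExp 0 d := funext (malcevProd_eq hZ)
  rw [this]; exact hZ.chain.continuous_prodExp d 0

theorem continuous_coord : Continuous hZ.coord := hZ.chain.continuous_coord d 0

theorem continuous_res : Continuous hZ.res := hZ.chain.continuous_res d 0

/-- The phase factor of the induced representation. -/
noncomputable def phase (g : ExpGroup 𝔤) (t : Fin d → ℝ) : ℂ :=
  character ℓ (hZ.res (g⁻¹ * malcevProd Z t))⁻¹

/-- The action of `G` on `G/H` in the coordinates `t`. -/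
noncomputable def shift (g : ExpGroup 𝔤) (t : Fin d → ℝ) : Fin d → ℝ :=
  hZ.coord (g⁻¹ * malcevProd Z t)

theorem continuous_character : Continuous (character (𝔤 := 𝔤) ℓ) := by
  have : Continuous fun h : ExpGroup 𝔤 => ℓ h.log :=
    ℓ.continuous_of_finiteDimensional.comp continuous_log
  unfold character
  fun_prop

theorem continuous_phase : Continuous fun p : ExpGroup 𝔤 × (Fin d → ℝ) => hZ.phase ℓ p.1 p.2 :=
  (continuous_character ℓ).comp (hZ.continuous_res.comp
    (continuous_fst.inv.mul (hZ.continuous_malcevProd.comp continuous_snd))).inv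

theorem continuous_shift : Continuous fun p : ExpGroup 𝔤 × (Fin d → ℝ) => hZ.shift p.1 p.2 :=
  hZ.continuous_coord.comp
    (continuous_fst.inv.mul (hZ.continuous_malcevProd.comp continuous_snd))

theorem continuous_shift_right (g : ExpGroup 𝔤) : Continuous (hZ.shift g) :=
  hZ.continuous_coord.comp (continuous_const.mul hZ.continuous_malcevProd)

/-- The action as a continuous map. -/
noncomputable def shiftMap (g : ExpGroup 𝔤) : C(Fin d → ℝ, Fin d → ℝ) :=
  ⟨hZ.shift g, hZ.continuous_shift_right g⟩

theorem continuous_shiftMap : Continuous hZ.shiftMap :=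
  ContinuousMap.continuous_of_continuous_uncurry _ hZ.continuous_shift

theorem measurePreserving_shift (g : ExpGroup 𝔤) :
    MeasurePreserving (hZ.shift g) volume volume := by
  have h := hZ.chain.measurePreserving d 0 (by omega) g⁻¹ (hZ.tailSpan_zero _)
  have h2 : hZ.shift g = fun t => hZ.chain.coord 0 d (g⁻¹ * hZ.chain.prodExp 0 d t) := by
    funext t; rw [shift, malcevProd_eq hZ]; rfl
  rw [h2]; exact h

theorem norm_phase (g : ExpGroup 𝔤) (t : Fin d → ℝ) : ‖hZ.phase ℓ g t‖ = 1 := norm_character ℓ _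

/-- The operator `ξ ↦ (t ↦ ξ̃(g⁻¹ E(t)))`. -/
noncomputable def inducedOp (g : ExpGroup 𝔤) :
    Lp ℂ 2 (volume : Measure (Fin d → ℝ)) →ₗᵢ[ℂ] Lp ℂ 2 (volume : Measure (Fin d → ℝ)) :=
  TwistedComp.twist (hZ.phase ℓ g)
    ((hZ.continuous_phase ℓ).comp (Continuous.prodMk_right g)).aestronglyMeasurable
    (hZ.norm_phase ℓ g) (hZ.shift g) (hZ.measurePreserving_shift g)

theorem inducedOp_ae (g : ExpGroup 𝔤) (ξ : Lp ℂ 2 (volume : Measure (Fin d → ℝ))) :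
    hZ.inducedOp ℓ g ξ =ᵐ[volume] fun t => hZ.covariantExtension ℓ ξ (g⁻¹ * malcevProd Z t) :=
  TwistedComp.twist_ae _ _ _ _ _ ξ

theorem inducedOp_one (ξ : Lp ℂ 2 (volume : Measure (Fin d → ℝ))) : hZ.inducedOp ℓ 1 ξ = ξ := by
  ext1
  filter_upwards [hZ.inducedOp_ae ℓ 1 ξ] with t ht
  have h1 : (1 : ExpGroup 𝔤).log ∈ 𝔥 := zero_mem _
  have := hZ.covariantExtension_apply ℓ ξ t h1
  rw [ht, inv_one, one_mul]
  rw [mul_one] at this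
  rw [this]
  simp [character, log_one]

theorem inducedOp_mul (hℓ : ∀ x ∈ 𝔥, ∀ y ∈ 𝔥, ℓ ⁅x, y⁆ = 0) (g g' : ExpGroup 𝔤)
    (ξ : Lp ℂ 2 (volume : Measure (Fin d → ℝ))) :
    hZ.inducedOp ℓ (g * g') ξ = hZ.inducedOp ℓ g (hZ.inducedOp ℓ g' ξ) := by
  ext1
  filter_upwards [hZ.inducedOp_ae ℓ (g * g') ξ, hZ.inducedOp_ae ℓ g (hZ.inducedOp ℓ g' ξ),
    (hZ.measurePreserving_shift g).quasiMeasurePreserving.ae (hZ.inducedOp_ae ℓ g' ξ)]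
    with t h1 h2 h3
  rw [h1, h2, covariantExtension, covariantExtension]
  have h3' : (hZ.inducedOp ℓ g' ξ) (hZ.coord (g⁻¹ * malcevProd Z t))
    = hZ.covariantExtension ℓ ξ (g'⁻¹ * malcevProd Z (hZ.coord (g⁻¹ * malcevProd Z t))) := h3
  rw [h3', covariantExtension]
  obtain ⟨e1, e2⟩ := hZ.coord_mul (g⁻¹ * malcevProd Z t) g'⁻¹
  rw [mul_inv_rev, mul_assoc, e1, e2, mul_inv_rev,
    character_mul ℓ hℓ (hZ.inv_res_mem _) (hZ.inv_res_mem _), mul_assoc]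

/-- The multiplication by the phase. -/
noncomputable def phaseOp (g : ExpGroup 𝔤) :
    Lp ℂ 2 (volume : Measure (Fin d → ℝ)) →ₗᵢ[ℂ] Lp ℂ 2 (volume : Measure (Fin d → ℝ)) :=
  TwistedComp.mulU (hZ.phase ℓ g)
    ((hZ.continuous_phase ℓ).comp (Continuous.prodMk_right g)).aestronglyMeasurable
    (hZ.norm_phase ℓ g)

theorem inducedOp_eq (g : ExpGroup 𝔤) (ξ : Lp ℂ 2 (volume : Measure (Fin d → ℝ))) :
    hZ.inducedOp ℓ g ξ = hZ.phaseOp ℓ g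
      (Lp.compMeasurePreserving (hZ.shiftMap g) (hZ.measurePreserving_shift g) ξ) := rfl

theorem continuous_phaseOp (ξ : Lp ℂ 2 (volume : Measure (Fin d → ℝ))) :
    Continuous fun g => hZ.phaseOp ℓ g ξ := by
  have hc : ∀ t, Continuous fun g => hZ.phase ℓ g t := fun t =>
    (continuous_character ℓ).comp (hZ.continuous_res.comp
      (continuous_inv.mul continuous_const)).inv
  have hm : ∀ g, AEStronglyMeasurable (hZ.phase ℓ g) volume := fun g =>
    ((hZ.continuous_phase ℓ).comp (Continuous.prodMk_right g)).aestronglyMeasurable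
  unfold phaseOp
  exact TwistedComp.continuous_mulU (hZ.phase ℓ) hm (hZ.norm_phase ℓ) hc ξ

theorem continuous_of_isometries {A H : Type*} [TopologicalSpace A] [NormedAddCommGroup H]
    [InnerProductSpace ℂ H] (T : A → H →ₗᵢ[ℂ] H) (hT : ∀ ξ, Continuous fun a => T a ξ) {f : A → H}
    (hf : Continuous f) : Continuous fun a => T a (f a) := by
  rw [continuous_iff_continuousAt]
  intro a₀
  have hd : Filter.Tendsto (fun a => T a (f a - f a₀)) (nhds a₀) (nhds 0) := by
    rw [tendsto_zero_iff_norm_tendsto_zero]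
    simp only [LinearIsometry.norm_map]
    rw [← tendsto_zero_iff_norm_tendsto_zero, ← sub_self (f a₀)]
    exact (hf.tendsto a₀).sub_const (f a₀)
  have := hd.add ((hT (f a₀)).tendsto a₀)
  rw [zero_add] at this
  refine this.congr fun a => ?_
  rw [map_sub, sub_add_cancel]

theorem continuous_inducedOp (ξ : Lp ℂ 2 (volume : Measure (Fin d → ℝ))) :
    Continuous fun g => hZ.inducedOp ℓ g ξ := by
  have hcomp : Continuous fun g =>
      Lp.compMeasurePreserving (hZ.shiftMap g) (hZ.measurePreserving_shift g) ξ :=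
    Continuous.compMeasurePreservingLp continuous_const hZ.continuous_shiftMap _ (by norm_num)
  simp only [inducedOp_eq]
  exact continuous_of_isometries (hZ.phaseOp ℓ) (hZ.continuous_phaseOp ℓ) hcomp

/-- The operator as a unitary operator. -/
noncomputable def inducedEquiv (hℓ : ∀ x ∈ 𝔥, ∀ y ∈ 𝔥, ℓ ⁅x, y⁆ = 0) (g : ExpGroup 𝔤) :
    Lp ℂ 2 (volume : Measure (Fin d → ℝ)) ≃ₗᵢ[ℂ] Lp ℂ 2 (volume : Measure (Fin d → ℝ)) where
  toLinearEquiv := LinearEquiv.ofLinearMap (hZ.inducedOp ℓ g).toLinearMap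
    (hZ.inducedOp ℓ g⁻¹).toLinearMap
    (by
      refine LinearMap.ext fun ξ => ?_
      change hZ.inducedOp ℓ g (hZ.inducedOp ℓ g⁻¹ ξ) = ξ
      rw [← hZ.inducedOp_mul ℓ hℓ, mul_inv_cancel, hZ.inducedOp_one])
    (by
      refine LinearMap.ext fun ξ => ?_
      change hZ.inducedOp ℓ g⁻¹ (hZ.inducedOp ℓ g ξ) = ξ
      rw [← hZ.inducedOp_mul ℓ hℓ, inv_mul_cancel, hZ.inducedOp_one])
  norm_map' := (hZ.inducedOp ℓ g).norm_map

theorem inducedEquiv_apply (hℓ : ∀ x ∈ 𝔥, ∀ y ∈ 𝔥, ℓ ⁅x, y⁆ = 0) (g : ExpGroup 𝔤)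
    (ξ : Lp ℂ 2 (volume : Measure (Fin d → ℝ))) :
    hZ.inducedEquiv ℓ hℓ g ξ = hZ.inducedOp ℓ g ξ := rfl

/-- The representation `σ_{ℓ,𝔥}` of `G` induced by `χ_ℓ`, `(σ(g) ξ̃)(u) = ξ̃(g⁻¹ u)`, realized on
`L²(ℝᵈ)` by means of `E`. -/
noncomputable def inducedRep (hℓ : ∀ x ∈ 𝔥, ∀ y ∈ 𝔥, ℓ ⁅x, y⁆ = 0) :
    UnitaryRep (ExpGroup 𝔤) (Lp ℂ 2 (volume : Measure (Fin d → ℝ))) where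
  toHom :=
    { toFun := hZ.inducedEquiv ℓ hℓ
      map_one' := LinearIsometryEquiv.ext fun ξ => by
        rw [inducedEquiv_apply, inducedOp_one]; rfl
      map_mul' := fun g g' => LinearIsometryEquiv.ext fun ξ => by
        rw [inducedEquiv_apply, hZ.inducedOp_mul ℓ hℓ, ← inducedEquiv_apply (hℓ := hℓ),
          ← inducedEquiv_apply (hℓ := hℓ)]
        rfl }
  continuous_apply := hZ.continuous_inducedOp ℓ

theorem inducedRep_ae (hℓ : ∀ x ∈ 𝔥, ∀ y ∈ 𝔥, ℓ ⁅x, y⁆ = 0) (g : ExpGroup 𝔤)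
    (ξ : Lp ℂ 2 (volume : Measure (Fin d → ℝ))) :
    (hZ.inducedRep ℓ hℓ).toHom g ξ
      =ᵐ[volume] fun t => hZ.covariantExtension ℓ ξ (g⁻¹ * malcevProd Z t) :=
  hZ.inducedOp_ae ℓ g ξ

end IsMalcevBasis

/-! Every object attached to a Malcev basis is a continuous function of that basis, provided the
basis does not degenerate. Orthonormality prevents this: the relations `B (Z i) (Z j) = δ_ij`
survive the limit, so the limit vectors are independent and, by dimension, a basis. The tail span of
index `j` is the set of common zeros of the forms `B (Z i)` with `i < j`. These are closed
conditions that vary continuously with the basis, so closure under brackets passes to the limit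
(`exists_of_tendsto`). The vanishing of `ℓ` on brackets passes to the limit because each vector of
the limit subalgebra is a limit of vectors of the subalgebras `𝔥 k`
(`apply_lie_eq_zero_of_tendsto`).

For the representations, more than weak convergence holds: `σ_k(a) ξ` tends to `σ(a) ξ` in norm. The
factorization `u = E(t) h` is computed by finitely many steps that use only the group operations,
the vectors `Z j` and their dual forms `B (Z j)`, hence `t` and `h` depend continuously on the basis
and on `u` jointly. So, for fixed `g`, the measure preserving maps by which `g` acts on `ℝᵈ`
converge locally uniformly, and the phases of modulus one converge pointwise. Continuity of
composition in `L²` and dominated convergence give `σ_k(g) ξ → σ(g) ξ` (`tendsto_inducedOp`).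

It remains to pass from `G` to `C*(G)`. Dominated convergence in `g` treats `L¹(G)` and also the
adjoints of its integrated forms. Uniform norm bounds give the star algebra generated by `L¹(G)`,
and a density argument gives its closure (`tendsto_onCStar`), because evaluation at a representation
is contractive for the norm of `C*(G)`. -/

open Filter Topology MeasureTheory

/-! ### Joint limits of linear forms, bilinear forms and brackets in finite dimension. -/

section LinearForms
variable {V ι : Type*} [AddCommGroup V] [Module ℝ V] [TopologicalSpace V]
  [IsTopologicalAddGroup V] [ContinuousSMul ℝ V] [T2Space V] [FiniteDimensional ℝ V]
  {F : Filter ι}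

/-- Linear forms that converge pointwise converge along convergent vectors. -/
theorem tendsto_linearForm_apply {φ : ι → Module.Dual ℝ V} {φ' : Module.Dual ℝ V}
    (hφ : ∀ x, Tendsto (fun i => φ i x) F (𝓝 (φ' x))) {x : ι → V} {x' : V}
    (hx : Tendsto x F (𝓝 x')) : Tendsto (fun i => φ i (x i)) F (𝓝 (φ' x')) := by
  set b := Module.finBasis ℝ V
  -- In a fixed basis the pairing is a finite sum of products, and each factor converges separately.
  have h : ∀ (ψ : Module.Dual ℝ V) (v : V), ψ v = ∑ j, b.coord j v * ψ (b j) := by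
    intro ψ v
    conv_lhs => rw [← b.sum_repr v]
    simp only [map_sum, map_smul, smul_eq_mul, Module.Basis.coord_apply]
  rw [h φ' x']
  refine Tendsto.congr (fun i => (h (φ i) (x i)).symm) ?_
  exact tendsto_finsetSum _ fun j _ =>
    (((b.coord j).continuous_of_finiteDimensional.tendsto x').comp hx).mul (hφ (b j))

/-- The forms `B (x i)` converge pointwise because `B.flip v` is a linear form on a finite
dimensional space, hence continuous. No continuity of `B` has to be assumed. -/
theorem tendsto_bilinForm_apply (B : LinearMap.BilinForm ℝ V) {x y : ι → V} {x' y' : V}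
    (hx : Tendsto x F (𝓝 x')) (hy : Tendsto y F (𝓝 y')) :
    Tendsto (fun i => B (x i) (y i)) F (𝓝 (B x' y')) :=
  tendsto_linearForm_apply (φ := fun i => B (x i))
    (fun v => ((B.flip v).continuous_of_finiteDimensional.tendsto x').comp hx) hy

end LinearForms

theorem BCHAux.tendsto_lie {L ι : Type*} [LieRing L] [LieAlgebra ℝ L] [TopologicalSpace L]
    [IsTopologicalAddGroup L] [ContinuousSMul ℝ L] [T2Space L] [FiniteDimensional ℝ L]
    {F : Filter ι} {x y : ι → L} {x' y' : L} (hx : Tendsto x F (𝓝 x')) (hy : Tendsto y F (𝓝 y')) :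
    Tendsto (fun i => ⁅x i, y i⁆) F (𝓝 ⁅x', y'⁆) :=
  ((continuous_lie (continuous_fst (X := L) (Y := L)) continuous_snd).tendsto (x', y')).comp
    (hx.prodMk_nhds hy)

/-! ### Orthonormal systems and their tail spans. -/

section Orthonormal
variable {V : Type*} [AddCommGroup V] [Module ℝ V] {n : ℕ} (B : LinearMap.BilinForm ℝ V)
  {Z : Fin n → V}

/-- Pairing a relation with `Z i` isolates its `i`-th coefficient. Applied to the limit vectors,
this excludes a degenerate limit. -/
theorem linearIndependent_of_orthonormal (horth : ∀ i j, B (Z i) (Z j) = if i = j then 1 else 0) :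
    LinearIndependent ℝ Z := by
  rw [Fintype.linearIndependent_iff]
  intro a ha i
  have := congrArg (B (Z i)) ha
  simpa [map_sum, horth] using this

/-- This replaces a span, which is awkward under limits, by finitely many equations whose
coefficients depend continuously on the basis. -/
theorem mem_tailSpan_iff_of_orthonormal
    (horth : ∀ i j, B (Z i) (Z j) = if i = j then 1 else 0)
    (hspan : Submodule.span ℝ (Set.range Z) = ⊤) (j : ℕ) (x : V) :
    x ∈ tailSpan Z j ↔ ∀ i : Fin n, (i : ℕ) < j → B (Z i) x = 0 := by
  constructor
  · intro hx i hi
    have hle : tailSpan Z j ≤ LinearMap.ker (B (Z i)) := by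
      rw [tailSpan, Submodule.span_le]
      rintro _ ⟨k, hk, rfl⟩
      have hk' : j ≤ (k : ℕ) := hk
      have hik : i ≠ k := by rintro rfl; omega
      simp [horth, hik]
    exact hle hx
  · intro h
    have hx : x ∈ Submodule.span ℝ (Set.range Z) := hspan ▸ Submodule.mem_top
    obtain ⟨a, rfl⟩ := (Submodule.mem_span_range_iff_exists_fun ℝ).mp hx
    -- In the expansion of the vector, the coefficients of index below `j` are its pairings with the
    -- `Z i` and vanish; the other terms lie in the tail span.
    refine Submodule.sum_mem _ fun i _ => ?_
    by_cases hi : (i : ℕ) < j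
    · have := h i hi
      have h0 : a i = 0 := by simpa [map_sum, horth] using this
      rw [h0, zero_smul]
      exact zero_mem _
    · exact Submodule.smul_mem _ _ (Submodule.subset_span ⟨i, not_lt.mp hi, rfl⟩)

variable [TopologicalSpace V] [IsTopologicalAddGroup V] [ContinuousSMul ℝ V]

/-- Vectors of the tail span of the limit are limits of vectors of the tail spans. -/
theorem exists_tendsto_of_mem_tailSpan {ι : Type*} {F : Filter ι} {W : ι → Fin n → V}
    (hlim : ∀ i, Tendsto (fun k => W k i) F (𝓝 (Z i))) {j : ℕ} {x : V} (hx : x ∈ tailSpan Z j) :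
    ∃ y : ι → V, (∀ k, y k ∈ tailSpan (W k) j) ∧ Tendsto y F (𝓝 x) := by
  -- The approximating vectors keep the coefficients of `x` and use `W k i` in place of `Z i`; the
  -- induction builds them generator by generator.
  refine Submodule.span_induction (p := fun x _ => ∃ y : ι → V,
    (∀ k, y k ∈ tailSpan (W k) j) ∧ Tendsto y F (𝓝 x)) ?_ ?_ ?_ ?_ hx
  · rintro _ ⟨i, hi, rfl⟩
    exact ⟨fun k => W k i, fun k => Submodule.subset_span ⟨i, hi, rfl⟩, hlim i⟩
  · exact ⟨0, fun _ => zero_mem _, tendsto_const_nhds⟩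
  · rintro _ _ _ _ ⟨y, hy, hyl⟩ ⟨z, hz, hzl⟩
    exact ⟨fun k => y k + z k, fun k => add_mem (hy k) (hz k), hyl.add hzl⟩
  · rintro a _ _ ⟨y, hy, hyl⟩
    exact ⟨fun k => a • y k, fun k => Submodule.smul_mem _ a (hy k), hyl.const_smul a⟩

end Orthonormal

/-! ### The limit basis: Malcev property and vanishing of the limit form on brackets. -/

namespace IsMalcevBasis

section Limit
variable {𝔤 : Type*} [LieRing 𝔤] [LieAlgebra ℝ 𝔤] {d m : ℕ} (B : LinearMap.BilinForm ℝ 𝔤)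

/-- The dual basis of an orthonormal basis is given by the form itself, so the coordinate forms
visibly depend continuously on the basis and no matrix has to be inverted. -/
theorem basis_coord_eq {𝔥 : LieSubalgebra ℝ 𝔤} {Z : Fin (d + m) → 𝔤} (hZ : IsMalcevBasis 𝔥 Z)
    (horth : ∀ i j, B (Z i) (Z j) = if i = j then 1 else 0) (i : Fin (d + m)) :
    hZ.basis.coord i = B (Z i) := by
  refine hZ.basis.ext fun j => ?_
  rw [hZ.basis_apply j, horth, ← hZ.basis_apply j]
  simp [Finsupp.single_apply, eq_comm]

variable [TopologicalSpace 𝔤] [IsTopologicalAddGroup 𝔤] [ContinuousSMul ℝ 𝔤] [T2Space 𝔤]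
  [FiniteDimensional ℝ 𝔤] {𝔥 : ℕ → LieSubalgebra ℝ 𝔤} {Z : ℕ → Fin (d + m) → 𝔤}
  {Z' : Fin (d + m) → 𝔤}

theorem orthonormal_of_tendsto (horth : ∀ k i j, B (Z k i) (Z k j) = if i = j then 1 else 0)
    (hlim : ∀ i, Tendsto (fun k => Z k i) atTop (𝓝 (Z' i))) (i j : Fin (d + m)) :
    B (Z' i) (Z' j) = if i = j then 1 else 0 := by
  refine tendsto_nhds_unique (tendsto_bilinForm_apply B (hlim i) (hlim j)) ?_
  simp only [horth]
  exact tendsto_const_nhds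

/-- The limit of orthonormal Malcev bases is a Malcev basis through the limit subalgebra. -/
theorem exists_of_tendsto (hZ : ∀ k, IsMalcevBasis (𝔥 k) (Z k))
    (horth : ∀ k i j, B (Z k i) (Z k j) = if i = j then 1 else 0)
    (hlim : ∀ i, Tendsto (fun k => Z k i) atTop (𝓝 (Z' i))) :
    ∃ 𝔥' : LieSubalgebra ℝ 𝔤, IsMalcevBasis 𝔥' Z' := by
  have horth' := orthonormal_of_tendsto B horth hlim
  have hli := linearIndependent_of_orthonormal B horth'
  have hspan : Submodule.span ℝ (Set.range Z') = ⊤ :=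
    -- Any one of the given bases, here that of index `0`, shows that the dimension is `d + m`.
    hli.span_eq_top_of_card_eq_finrank' (Module.finrank_eq_card_basis (hZ 0).basis).symm
  have hlie : ∀ j ≤ d, ∀ x ∈ tailSpan Z' j, ∀ y ∈ tailSpan Z' j, ⁅x, y⁆ ∈ tailSpan Z' j := by
    intro j hj x hx y hy
    obtain ⟨u, hu, hul⟩ := exists_tendsto_of_mem_tailSpan hlim hx
    obtain ⟨v, hv, hvl⟩ := exists_tendsto_of_mem_tailSpan hlim hy
    -- Each equation to be checked for `⁅x, y⁆` is the limit of the same equation for `⁅u k, v k⁆`,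
    -- which holds since the tail spans of `Z k` are subalgebras.
    rw [mem_tailSpan_iff_of_orthonormal B horth' hspan]
    intro i hi
    refine tendsto_nhds_unique
      (tendsto_bilinForm_apply B (hlim i) (BCHAux.tendsto_lie hul hvl)) ?_
    have : ∀ k, B (Z k i) ⁅u k, v k⁆ = 0 := fun k =>
      (mem_tailSpan_iff_of_orthonormal B (horth k) (hZ k).span_eq_top j _).mp
        ((hZ k).lie_mem j hj _ (hu k) _ (hv k)) i hi
    simp only [this]
    exact tendsto_const_nhds
  -- The limit subalgebra is the tail span of index `d` itself, so the last field of the Malcev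
  -- property holds by definition.
  exact ⟨{ tailSpan Z' d with lie_mem' := fun hx hy => hlie d le_rfl _ hx _ hy },
    hli, hspan, hlie, rfl⟩

/-- Vectors of `𝔥'` are limits of vectors `u k`, `v k` of `𝔥 k`, where `ℓ k ⁅u k, v k⁆ = 0`. The
forms and the brackets both converge, hence so does the pairing. -/
theorem apply_lie_eq_zero_of_tendsto (hZ : ∀ k, IsMalcevBasis (𝔥 k) (Z k))
    {𝔥' : LieSubalgebra ℝ 𝔤} (hZ' : IsMalcevBasis 𝔥' Z')
    (hlim : ∀ i, Tendsto (fun k => Z k i) atTop (𝓝 (Z' i)))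
    {ℓ : ℕ → Module.Dual ℝ 𝔤} {ℓ' : Module.Dual ℝ 𝔤}
    (hℓ : ∀ x, Tendsto (fun k => ℓ k x) atTop (𝓝 (ℓ' x)))
    (hiso : ∀ k, ∀ x ∈ 𝔥 k, ∀ y ∈ 𝔥 k, ℓ k ⁅x, y⁆ = 0) :
    ∀ x ∈ 𝔥', ∀ y ∈ 𝔥', ℓ' ⁅x, y⁆ = 0 := by
  intro x hx y hy
  rw [← LieSubalgebra.mem_toSubmodule, ← hZ'.tailSpan_eq] at hx hy
  obtain ⟨u, hu, hul⟩ := exists_tendsto_of_mem_tailSpan hlim hx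
  obtain ⟨v, hv, hvl⟩ := exists_tendsto_of_mem_tailSpan hlim hy
  refine tendsto_nhds_unique (tendsto_linearForm_apply hℓ (BCHAux.tendsto_lie hul hvl)) ?_
  have : ∀ k, ℓ k ⁅u k, v k⁆ = 0 := by
    intro k
    have h1 := hu k
    have h2 := hv k
    rw [(hZ k).tailSpan_eq] at h1 h2
    exact hiso k _ h1 _ h2
  simp only [this]
  exact tendsto_const_nhds

end Limit
end IsMalcevBasis

/-! ### Coordinates of the second kind depend continuously on the chain and the group element. -/

namespace ExpGroup.Chain
variable {𝔤 ι : Type*} [LieRing 𝔤] [LieAlgebra ℝ 𝔤] [LieRing.IsNilpotent 𝔤] {d : ℕ}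
  [TopologicalSpace 𝔤] [IsTopologicalAddGroup 𝔤] [ContinuousSMul ℝ 𝔤] [T2Space 𝔤]
  [FiniteDimensional ℝ 𝔤] {F : Filter ι} {Γ : ι → Chain 𝔤 d} {Γ' : Chain 𝔤 d}

/-- The filter is arbitrary so that the chain and the group element can move together. Along `atTop
×ˢ 𝓝 t` this will express local uniformity in `t`. -/
theorem tendsto_c (hc : ∀ j x, Tendsto (fun i => (Γ i).c j x) F (𝓝 (Γ'.c j x)))
    {u : ι → ExpGroup 𝔤} {u' : ExpGroup 𝔤} (hu : Tendsto u F (𝓝 u')) (j : ℕ) :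
    Tendsto (fun i => (Γ i).c j (u i).log) F (𝓝 (Γ'.c j u'.log)) :=
  tendsto_linearForm_apply (hc j) ((continuous_log.tendsto u').comp hu)

theorem tendsto_strip (hZ : ∀ j, Tendsto (fun i => (Γ i).Z j) F (𝓝 (Γ'.Z j)))
    (hc : ∀ j x, Tendsto (fun i => (Γ i).c j x) F (𝓝 (Γ'.c j x)))
    {u : ι → ExpGroup 𝔤} {u' : ExpGroup 𝔤} (hu : Tendsto u F (𝓝 u')) (j : ℕ) :
    Tendsto (fun i => (Γ i).strip j (u i)) F (𝓝 (Γ'.strip j u')) :=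
  Tendsto.mul ((continuous_exp.tendsto _).comp ((tendsto_c hc hu j).smul (hZ j)).neg) hu

theorem tendsto_prodExp (hZ : ∀ j, Tendsto (fun i => (Γ i).Z j) F (𝓝 (Γ'.Z j))) (l : ℕ) :
    ∀ (j : ℕ) {t : ι → Fin l → ℝ} {t' : Fin l → ℝ}, Tendsto t F (𝓝 t') →
      Tendsto (fun i => (Γ i).prodExp j l (t i)) F (𝓝 (Γ'.prodExp j l t')) := by
  induction l with
  | zero => intro j t t' _; exact tendsto_const_nhds
  | succ l ih =>
    intro j t t' ht
    rw [tendsto_pi_nhds] at ht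
    exact Tendsto.mul ((continuous_exp.tendsto _).comp ((ht 0).smul (hZ j)))
      (ih (j + 1) (tendsto_pi_nhds.mpr fun i => ht i.succ))

/-- The leading coordinate is the value of a convergent form, and the others are coordinates of the
stripped element, which converges by `tendsto_strip`. The induction therefore has to allow any
starting index and any convergent family. -/
theorem tendsto_coord (hZ : ∀ j, Tendsto (fun i => (Γ i).Z j) F (𝓝 (Γ'.Z j)))
    (hc : ∀ j x, Tendsto (fun i => (Γ i).c j x) F (𝓝 (Γ'.c j x))) (l : ℕ) :
    ∀ (j : ℕ) {u : ι → ExpGroup 𝔤} {u' : ExpGroup 𝔤}, Tendsto u F (𝓝 u') →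
      Tendsto (fun i => (Γ i).coord j l (u i)) F (𝓝 (Γ'.coord j l u')) := by
  induction l with
  | zero => intro j u u' _; exact tendsto_pi_nhds.mpr fun i => i.elim0
  | succ l ih =>
    intro j u u' hu
    refine tendsto_pi_nhds.mpr fun i => ?_
    refine Fin.cases ?_ (fun i => ?_) i
    · exact tendsto_c hc hu j
    · exact tendsto_pi_nhds.mp (ih (j + 1) (tendsto_strip hZ hc hu j)) i

theorem tendsto_res (hZ : ∀ j, Tendsto (fun i => (Γ i).Z j) F (𝓝 (Γ'.Z j)))
    (hc : ∀ j x, Tendsto (fun i => (Γ i).c j x) F (𝓝 (Γ'.c j x))) (l : ℕ) :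
    ∀ (j : ℕ) {u : ι → ExpGroup 𝔤} {u' : ExpGroup 𝔤}, Tendsto u F (𝓝 u') →
      Tendsto (fun i => (Γ i).res j l (u i)) F (𝓝 (Γ'.res j l u')) := by
  induction l with
  | zero => intro j u u' hu; exact hu
  | succ l ih => intro j u u' hu; exact ih (j + 1) (tendsto_strip hZ hc hu j)

end ExpGroup.Chain

/-! ### Strong limits of unimodular multiplication operators and of isometries. -/

namespace TwistedComp

/-- Dominated convergence applied to `|θ a - θ'|² |f|²`, which is at most `(2 |f|)²`. Pointwise
convergence of the multipliers is enough; the filter is countably generated so that dominated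
convergence is available along it. -/
theorem tendsto_mulU {X ι : Type*} [MeasurableSpace X] {μ : Measure X} {F : Filter ι}
    [F.IsCountablyGenerated] {θ : ι → X → ℂ} {θ' : X → ℂ}
    (hθ : ∀ a, AEStronglyMeasurable (θ a) μ) (h1 : ∀ a x, ‖θ a x‖ = 1)
    (hθ' : AEStronglyMeasurable θ' μ) (h1' : ∀ x, ‖θ' x‖ = 1)
    (hc : ∀ x, Tendsto (fun a => θ a x) F (𝓝 (θ' x))) (f : Lp ℂ 2 μ) :
    Tendsto (fun a => mulU (θ a) (hθ a) (h1 a) f) F (𝓝 (mulU θ' hθ' h1' f)) := by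
  refine (Lp.tendsto_Lp_iff_tendsto_eLpNorm'' (fun a x => θ a x * f x)
    (fun a => memLp_mul (hθ a) (h1 a) (Lp.memLp f)) (fun x => θ' x * f x)
    (memLp_mul hθ' h1' (Lp.memLp f))).mpr ?_
  have h2 : (2 : ENNReal) ≠ 0 := by norm_num
  have h2' : (2 : ENNReal) ≠ ⊤ := by norm_num
  simp only [eLpNorm_eq_lintegral_rpow_enorm_toReal h2 h2']
  -- The factor `2` bounds the difference of two numbers of modulus one.
  have hfin : ∫⁻ x, (2 * ‖f x‖ₑ) ^ (2 : ENNReal).toReal ∂μ ≠ ⊤ := by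
    have := lintegral_rpow_enorm_lt_top_of_eLpNorm_lt_top h2 h2' (Lp.memLp f).2
    simp only [ENNReal.mul_rpow_of_nonneg _ _ ENNReal.toReal_nonneg]
    rw [lintegral_const_mul' _ _ (by norm_num)]
    exact ENNReal.mul_ne_top (by norm_num) this.ne
  have hlim : Tendsto (fun a => ∫⁻ x, ‖((fun x => θ a x * f x) - fun x => θ' x * f x) x‖ₑ
      ^ (2 : ENNReal).toReal ∂μ) F (𝓝 (∫⁻ _, 0 ∂μ)) := by
    refine tendsto_lintegral_filter_of_dominated_convergence' _ ?_ ?_ hfin ?_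
    · refine Eventually.of_forall fun a => ?_
      refine AEMeasurable.pow_const ?_ _
      exact (((hθ a).mul (Lp.aestronglyMeasurable f)).sub
        (hθ'.mul (Lp.aestronglyMeasurable f))).enorm
    · refine Eventually.of_forall fun a => Eventually.of_forall fun x => ?_
      refine ENNReal.rpow_le_rpow ?_ ENNReal.toReal_nonneg
      simp only [Pi.sub_apply, ← sub_mul, enorm_mul]
      gcongr
      refine (enorm_sub_le).trans ?_
      rw [← ofReal_norm, ← ofReal_norm, h1, h1']
      norm_num
    · refine Eventually.of_forall fun x => ?_
      have hcont : Continuous fun z : ℂ => ‖z * f x - θ' x * f x‖ₑ ^ (2 : ENNReal).toReal :=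
        (ENNReal.continuous_rpow_const).comp
          (Continuous.enorm ((continuous_id.mul continuous_const).sub continuous_const))
      have h := (hcont.tendsto (θ' x)).comp (hc x)
      simpa [Function.comp_def] using h
  -- Taking the square root turns the integral back into the `L²` norm.
  have h3 := ((ENNReal.continuous_rpow_const (y := 1 / (2 : ENNReal).toReal)).tendsto _).comp hlim
  simpa [Function.comp_def] using h3

end TwistedComp

/-- Strong convergence of isometries is compatible with convergence of the arguments. -/
theorem tendsto_isometry_apply {ι E : Type*} [NormedAddCommGroup E] [NormedSpace ℂ E]
    {F : Filter ι} {T : ι → E →ₗᵢ[ℂ] E} {T' : E →ₗᵢ[ℂ] E}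
    (hT : ∀ ξ, Tendsto (fun i => T i ξ) F (𝓝 (T' ξ))) {f : ι → E} {f' : E}
    (hf : Tendsto f F (𝓝 f')) : Tendsto (fun i => T i (f i)) F (𝓝 (T' f')) := by
  -- Its norm is `‖f i - f'‖`, whatever the isometry `T i` is.
  have hd : Tendsto (fun i => T i (f i - f')) F (𝓝 0) := by
    rw [tendsto_zero_iff_norm_tendsto_zero]
    simp only [LinearIsometry.norm_map]
    rw [← tendsto_zero_iff_norm_tendsto_zero, ← sub_self f']
    exact hf.sub_const f'
  have := hd.add (hT f')
  rw [zero_add] at this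
  refine this.congr fun i => ?_
  rw [map_sub, sub_add_cancel]

/-! ### Strong convergence of the induced operators at a fixed group element. -/

namespace IsMalcevBasis
open ExpGroup

section Convergence
variable {𝔤 : Type*} [LieRing 𝔤] [LieAlgebra ℝ 𝔤] [LieRing.IsNilpotent 𝔤] {d m : ℕ}
  (B : LinearMap.BilinForm ℝ 𝔤)
  [TopologicalSpace 𝔤] [IsTopologicalAddGroup 𝔤] [ContinuousSMul ℝ 𝔤] [T2Space 𝔤]
  [FiniteDimensional ℝ 𝔤] {𝔥 : ℕ → LieSubalgebra ℝ 𝔤} {Z : ℕ → Fin (d + m) → 𝔤}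
  {Z' : Fin (d + m) → 𝔤} (hZ : ∀ k, IsMalcevBasis (𝔥 k) (Z k))
  {𝔥' : LieSubalgebra ℝ 𝔤} (hZ' : IsMalcevBasis 𝔥' Z')

theorem tendsto_chain_Z (hlim : ∀ i, Tendsto (fun k => Z k i) atTop (𝓝 (Z' i))) (j : ℕ) :
    Tendsto (fun k => (hZ k).chain.Z j) atTop (𝓝 (hZ'.chain.Z j)) := by
  by_cases hj : j < d
  · simpa [chain, hj] using hlim _
  -- From index `d` on, all the chains take the default value `0`, so the convergence hypotheses on
  -- chains hold for every index.
  · simp [chain, hj]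

/-- By `basis_coord_eq` the coordinate forms are the `B (Z k j)`; this is how orthonormality enters
the convergence of the coordinates. -/
theorem tendsto_chain_c (horth : ∀ k i j, B (Z k i) (Z k j) = if i = j then 1 else 0)
    (hlim : ∀ i, Tendsto (fun k => Z k i) atTop (𝓝 (Z' i))) (j : ℕ) (x : 𝔤) :
    Tendsto (fun k => (hZ k).chain.c j x) atTop (𝓝 (hZ'.chain.c j x)) := by
  by_cases hj : j < d
  · simp only [chain, hj, dif_pos, fun k => (hZ k).basis_coord_eq B (horth k),
      hZ'.basis_coord_eq B (orthonormal_of_tendsto B horth hlim)]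
    exact tendsto_bilinForm_apply B (hlim _) tendsto_const_nhds
  · simp [chain, hj]

variable {hZ hZ'}

/-- The coordinates and the residues of `g⁻¹ E_k(t)` converge locally uniformly in `t`. -/
theorem tendsto_coord_res (horth : ∀ k i j, B (Z k i) (Z k j) = if i = j then 1 else 0)
    (hlim : ∀ i, Tendsto (fun k => Z k i) atTop (𝓝 (Z' i))) (g : ExpGroup 𝔤) (t : Fin d → ℝ) :
    Tendsto (fun p : ℕ × (Fin d → ℝ) => (hZ p.1).shift g p.2) (atTop ×ˢ 𝓝 t)
      (𝓝 (hZ'.shift g t)) ∧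
    Tendsto (fun p : ℕ × (Fin d → ℝ) => (hZ p.1).res (g⁻¹ * malcevProd (Z p.1) p.2))
      (atTop ×ˢ 𝓝 t) (𝓝 (hZ'.res (g⁻¹ * malcevProd Z' t))) := by
  -- The chain depends on `k` alone, so its limits are pulled back along the first projection, while
  -- the argument of `E` moves along the second.
  have h1 : ∀ j, Tendsto (fun p : ℕ × (Fin d → ℝ) => (hZ p.1).chain.Z j) (atTop ×ˢ 𝓝 t)
      (𝓝 (hZ'.chain.Z j)) := fun j => (tendsto_chain_Z hZ hZ' hlim j).comp tendsto_fst
  have h2 : ∀ j x, Tendsto (fun p : ℕ × (Fin d → ℝ) => (hZ p.1).chain.c j x) (atTop ×ˢ 𝓝 t)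
      (𝓝 (hZ'.chain.c j x)) :=
    fun j x => (tendsto_chain_c B hZ hZ' horth hlim j x).comp tendsto_fst
  have h3 : Tendsto (fun p : ℕ × (Fin d → ℝ) => g⁻¹ * malcevProd (Z p.1) p.2) (atTop ×ˢ 𝓝 t)
      (𝓝 (g⁻¹ * malcevProd Z' t)) := by
    simp only [fun k => malcevProd_eq (hZ k), malcevProd_eq hZ']
    exact tendsto_const_nhds.mul (Chain.tendsto_prodExp h1 d 0 tendsto_snd)
  exact ⟨Chain.tendsto_coord h1 h2 d 0 h3, Chain.tendsto_res h1 h2 d 0 h3⟩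

/-- Convergence in `C(ℝᵈ, ℝᵈ)` is what continuity of composition in `L²` requires. It means locally
uniform convergence, which follows from the joint limit in `k` and `t` because the limit map is
continuous. -/
theorem tendsto_shiftMap (horth : ∀ k i j, B (Z k i) (Z k j) = if i = j then 1 else 0)
    (hlim : ∀ i, Tendsto (fun k => Z k i) atTop (𝓝 (Z' i))) (g : ExpGroup 𝔤) :
    Tendsto (fun k => (hZ k).shiftMap g) atTop (𝓝 (hZ'.shiftMap g)) := by
  rw [ContinuousMap.tendsto_iff_tendstoLocallyUniformly,
    tendstoLocallyUniformly_iff_forall_tendsto]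
  intro t
  have h1 : Tendsto (fun p : ℕ × (Fin d → ℝ) => hZ'.shiftMap g p.2) (atTop ×ˢ 𝓝 t)
      (𝓝 (hZ'.shiftMap g t)) :=
    ((hZ'.shiftMap g).continuous.tendsto t).comp tendsto_snd
  have h2 : Tendsto (fun p : ℕ × (Fin d → ℝ) => (hZ p.1).shiftMap g p.2) (atTop ×ˢ 𝓝 t)
      (𝓝 (hZ'.shiftMap g t)) :=
    (tendsto_coord_res (hZ := hZ) (hZ' := hZ') B horth hlim g t).1
  -- Both components tend to the same point, and neighbourhoods of a diagonal point are finer than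
  -- the uniformity.
  exact (h1.prodMk_nhds h2).mono_right (nhds_le_uniformity _)

/-- Pointwise convergence suffices for `tendsto_mulU`, so `t` is fixed here. The exponent pairs the
convergent forms `ℓ k` with the convergent logarithms of the `H`-components. -/
theorem tendsto_phase (horth : ∀ k i j, B (Z k i) (Z k j) = if i = j then 1 else 0)
    (hlim : ∀ i, Tendsto (fun k => Z k i) atTop (𝓝 (Z' i)))
    {ℓ : ℕ → Module.Dual ℝ 𝔤} {ℓ' : Module.Dual ℝ 𝔤}
    (hℓ : ∀ x, Tendsto (fun k => ℓ k x) atTop (𝓝 (ℓ' x))) (g : ExpGroup 𝔤) (t : Fin d → ℝ) :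
    Tendsto (fun k => (hZ k).phase (ℓ k) g t) atTop (𝓝 (hZ'.phase ℓ' g t)) := by
  have h1 : Tendsto (fun k => (hZ k).res (g⁻¹ * malcevProd (Z k) t)) atTop
      (𝓝 (hZ'.res (g⁻¹ * malcevProd Z' t))) :=
    (tendsto_coord_res (hZ := hZ) (hZ' := hZ') B horth hlim g t).2.comp
      (tendsto_id.prodMk tendsto_const_nhds)
  have h2 := tendsto_linearForm_apply hℓ ((continuous_log.tendsto _).comp h1.inv)
  have h3 : Continuous fun s : ℝ => Complex.exp (-(2 * Real.pi * Complex.I * s)) := by fun_prop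
  exact (h3.tendsto _).comp h2

/-- The operators `σ_k(g)` converge strongly to `σ(g)`. -/
theorem tendsto_inducedOp (horth : ∀ k i j, B (Z k i) (Z k j) = if i = j then 1 else 0)
    (hlim : ∀ i, Tendsto (fun k => Z k i) atTop (𝓝 (Z' i)))
    {ℓ : ℕ → Module.Dual ℝ 𝔤} {ℓ' : Module.Dual ℝ 𝔤}
    (hℓ : ∀ x, Tendsto (fun k => ℓ k x) atTop (𝓝 (ℓ' x))) (g : ExpGroup 𝔤)
    (ξ : Lp ℂ 2 (volume : Measure (Fin d → ℝ))) :
    Tendsto (fun k => (hZ k).inducedOp (ℓ k) g ξ) atTop (𝓝 (hZ'.inducedOp ℓ' g ξ)) := by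
  -- Composition with measure preserving maps is continuous in the map for a finite exponent; the
  -- side goal left to `norm_num` is `2 ≠ ∞`.
  have h1 : Tendsto (fun k => Lp.compMeasurePreserving ((hZ k).shiftMap g)
      ((hZ k).measurePreserving_shift g) ξ) atTop (𝓝 (Lp.compMeasurePreserving (hZ'.shiftMap g)
      (hZ'.measurePreserving_shift g) ξ)) :=
    Tendsto.compMeasurePreservingLp tendsto_const_nhds (tendsto_shiftMap B horth hlim g) _ _
      (by norm_num)
  simp only [inducedOp_eq]
  -- The induced operator is a phase multiplication after a composition; the strong limits combine
  -- because the multiplications are isometric.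
  refine tendsto_isometry_apply (T := fun k => (hZ k).phaseOp (ℓ k) g) (fun η => ?_) h1
  exact TwistedComp.tendsto_mulU _ _ _ _ (tendsto_phase B horth hlim hℓ g) η

end Convergence
end IsMalcevBasis

/-! ### From strong convergence on the group to strong convergence on its C*-algebra. -/

namespace UnitaryRep
variable {G : Type*} [Group G] [TopologicalSpace G]

theorem toHom_inner_left {H : Type*} [NormedAddCommGroup H] [InnerProductSpace ℂ H]
    (π : UnitaryRep G H) (g : G) (ξ η : H) :
    inner ℂ (π.toHom g⁻¹ ξ) η = inner ℂ ξ (π.toHom g η) := by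
  rw [← (π.toHom g).inner_map_map, map_inv]
  congr 1
  exact (π.toHom g).apply_symm_apply ξ

variable [IsTopologicalGroup G] [LocallyCompactSpace G] [SecondCountableTopology G]
  [MeasurableSpace G] [BorelSpace G]

section
variable {H : Type*} [NormedAddCommGroup H] [InnerProductSpace ℂ H]

theorem integrated_apply (π : UnitaryRep G H) (F : Lp ℂ 1 (Measure.haar (G := G))) (ξ : H) :
    π.integrated F ξ = ∫ g, F g • π.toHom g ξ ∂Measure.haar := rfl

theorem integrable_conj_smul_inv (π : UnitaryRep G H) (F : Lp ℂ 1 (Measure.haar (G := G)))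
    (ξ : H) :
    Integrable (fun g => (starRingEnd ℂ) (F g) • π.toHom g⁻¹ ξ) Measure.haar := by
  have hF : Integrable (fun g => (starRingEnd ℂ) (F g)) (Measure.haar (G := G)) :=
    LinearIsometryEquiv.integrable_comp_iff (Complex.conjLIE) |>.mpr (L1.integrable_coeFn F)
  refine hF.smul_of_top_left ?_
  refine memLp_top_of_bound
    ((π.continuous_apply ξ).comp continuous_inv).aestronglyMeasurable ‖ξ‖ ?_
  exact Eventually.of_forall fun g => by simp

/-- Under the integral sign, unitarity moves `π(g)` across the inner product as `π(g⁻¹)`. Keeping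
`g⁻¹` in the integrand, rather than substituting, avoids the modular function. -/
theorem adjoint_integrated_apply [CompleteSpace H] (π : UnitaryRep G H)
    (F : Lp ℂ 1 (Measure.haar (G := G))) (ξ : H) :
    (ContinuousLinearMap.adjoint (π.integrated F)) ξ
      = ∫ g, (starRingEnd ℂ) (F g) • π.toHom g⁻¹ ξ ∂Measure.haar := by
  refine ext_inner_left ℂ fun η => ?_
  rw [ContinuousLinearMap.adjoint_inner_right, ← inner_conj_symm, integrated_apply,
    ← integral_inner (π.integrable_smul F η), ← integral_conj,
    ← integral_inner (π.integrable_conj_smul_inv F ξ)]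
  refine integral_congr_ae (Eventually.of_forall fun g => ?_)
  simp only [inner_smul_right, map_mul]
  rw [← toHom_inner_left, inner_conj_symm]

variable {π : ℕ → UnitaryRep G H} {π' : UnitaryRep G H}

/-- Unitarity makes the bound `‖F g‖ * ‖ξ‖` independent of `k`, so dominated convergence applies. -/
theorem tendsto_integrated (h : ∀ g ξ, Tendsto (fun k => (π k).toHom g ξ) atTop
    (𝓝 (π'.toHom g ξ))) (F : Lp ℂ 1 (Measure.haar (G := G))) (ξ : H) :
    Tendsto (fun k => (π k).integrated F ξ) atTop (𝓝 (π'.integrated F ξ)) := by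
  simp only [integrated_apply]
  refine tendsto_integral_of_dominated_convergence (fun g => ‖F g‖ * ‖ξ‖)
    (fun k => ((π k).integrable_smul F ξ).1) ((L1.integrable_coeFn F).norm.mul_const _)
    (fun k => Eventually.of_forall fun g => ?_) (Eventually.of_forall fun g => ?_)
  · rw [norm_smul, LinearIsometryEquiv.norm_map]
  · exact (h g ξ).const_smul _

/-- Strong limits do not pass to adjoints in general. Here they do, since the adjoint is again an
average of operators of the representation, taken at `g⁻¹`. -/
theorem tendsto_adjoint_integrated [CompleteSpace H]
    (h : ∀ g ξ, Tendsto (fun k => (π k).toHom g ξ) atTop (𝓝 (π'.toHom g ξ)))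
    (F : Lp ℂ 1 (Measure.haar (G := G))) (ξ : H) :
    Tendsto (fun k => ContinuousLinearMap.adjoint ((π k).integrated F) ξ) atTop
      (𝓝 (ContinuousLinearMap.adjoint (π'.integrated F) ξ)) := by
  simp only [adjoint_integrated_apply]
  refine tendsto_integral_of_dominated_convergence (fun g => ‖F g‖ * ‖ξ‖)
    (fun k => ((π k).integrable_conj_smul_inv F ξ).1) ((L1.integrable_coeFn F).norm.mul_const _)
    (fun k => Eventually.of_forall fun g => ?_) (Eventually.of_forall fun g => ?_)
  · rw [norm_smul, LinearIsometryEquiv.norm_map, RCLike.norm_conj]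
  · exact (h g⁻¹ ξ).const_smul _

end

/-- Strong convergence of operators is compatible with composition when the norms are bounded. -/
theorem tendsto_clm_apply {H : Type*} [NormedAddCommGroup H] [NormedSpace ℂ H]
    {T : ℕ → H →L[ℂ] H} {T' : H →L[ℂ] H} {C : ℝ} (hC : ∀ k, ‖T k‖ ≤ C)
    (hT : ∀ ξ, Tendsto (fun k => T k ξ) atTop (𝓝 (T' ξ))) {f : ℕ → H} {f' : H}
    (hf : Tendsto f atTop (𝓝 f')) : Tendsto (fun k => T k (f k)) atTop (𝓝 (T' f')) := by
  have hd : Tendsto (fun k => T k (f k - f')) atTop (𝓝 0) := by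
    -- The uniform bound `C` gives `‖T k (f k - f')‖ ≤ C * ‖f k - f'‖`.
    refine squeeze_zero_norm (fun k => ((T k).le_of_opNorm_le (hC k) _)) ?_
    have h0 : Tendsto (fun k => f k - f') atTop (𝓝 0) := by
      rw [← sub_self f']; exact hf.sub_const f'
    simpa using h0.norm.const_mul C
  have := hd.add (hT f')
  rw [zero_add] at this
  refine this.congr fun k => ?_
  rw [map_sub, sub_add_cancel]

variable {H : Type} [NormedAddCommGroup H] [InnerProductSpace ℂ H] [CompleteSpace H]
  {π : ℕ → UnitaryRep G H} {π' : UnitaryRep G H}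

/-- The operator of an operator field at a representation. -/
def fieldAt (π : UnitaryRep G H) (a : OperatorFields G) : H →L[ℂ] H := a ⟨H, π⟩

/-- The norm of a field is the supremum over all representations. The bound is thus the same for
every `π k`, which the product and density arguments below rely on. -/
theorem norm_fieldAt_le (π : UnitaryRep G H) (a : OperatorFields G) : ‖π.fieldAt a‖ ≤ ‖a‖ :=
  lp.norm_apply_le_norm ENNReal.top_ne_zero a ⟨H, π⟩

/-- The statement for `a` and the one for `star a` are carried together: the induction passes
through `star`, and strong convergence at `a` alone would not give it at `star a`. -/
theorem tendsto_fieldAt_of_mem_adjoin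
    (h : ∀ g ξ, Tendsto (fun k => (π k).toHom g ξ) atTop (𝓝 (π'.toHom g ξ)))
    {a : OperatorFields G}
    (ha : a ∈ NonUnitalStarAlgebra.adjoin ℂ (Set.range (universalRep (G := G)))) :
    (∀ ξ, Tendsto (fun k => (π k).fieldAt a ξ) atTop (𝓝 (π'.fieldAt a ξ))) ∧
    (∀ ξ, Tendsto (fun k => (π k).fieldAt (star a) ξ) atTop (𝓝 (π'.fieldAt (star a) ξ))) := by
  refine NonUnitalStarAlgebra.adjoin_induction ℂ (p := fun a _ =>
    (∀ ξ, Tendsto (fun k => (π k).fieldAt a ξ) atTop (𝓝 (π'.fieldAt a ξ))) ∧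
    (∀ ξ, Tendsto (fun k => (π k).fieldAt (star a) ξ) atTop (𝓝 (π'.fieldAt (star a) ξ))))
    ?_ ?_ ?_ ?_ ?_ ?_ ha
  · rintro _ ⟨F, rfl⟩
    -- The coordinates of a generator are integrated forms, and `star` acts on fields as the adjoint
    -- in each coordinate.
    exact ⟨tendsto_integrated h F, tendsto_adjoint_integrated h F⟩
  · intro a b _ _ ha hb
    refine ⟨fun ξ => (ha.1 ξ).add (hb.1 ξ), fun ξ => ?_⟩
    rw [star_add]
    exact (ha.2 ξ).add (hb.2 ξ)
  · rw [star_zero]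
    exact ⟨fun ξ => tendsto_const_nhds, fun ξ => tendsto_const_nhds⟩
  · intro a b _ _ ha hb
    refine ⟨fun ξ => ?_, fun ξ => ?_⟩
    · exact tendsto_clm_apply (fun k => (π k).norm_fieldAt_le a) ha.1 (hb.1 ξ)
    · rw [star_mul]
      -- The star reverses products, so the outer operator is now the one of `star b`.
      exact tendsto_clm_apply (fun k => (π k).norm_fieldAt_le (star b)) hb.2 (ha.2 ξ)
  · intro r a _ ha
    refine ⟨fun ξ => (ha.1 ξ).const_smul r, fun ξ => ?_⟩
    rw [star_smul]
    exact (ha.2 ξ).const_smul (star r)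
  · intro a _ ha
    rw [star_star]
    exact ⟨ha.2, ha.1⟩

/-- Strong convergence on the group implies strong convergence on the group C*-algebra. -/
theorem tendsto_onCStar
    (h : ∀ g ξ, Tendsto (fun k => (π k).toHom g ξ) atTop (𝓝 (π'.toHom g ξ)))
    (a : groupCStarAlgebra G) (ξ : H) :
    Tendsto (fun k => (π k).onCStar a ξ) atTop (𝓝 (π'.onCStar a ξ)) := by
  obtain ⟨a, ha⟩ := a
  change Tendsto (fun k => (π k).fieldAt a ξ) atTop (𝓝 (π'.fieldAt a ξ))
  have hcl : a ∈ closure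
      (NonUnitalStarAlgebra.adjoin ℂ (Set.range (universalRep (G := G))) :
        Set (OperatorFields G)) := ha
  rw [Metric.tendsto_atTop]
  intro ε hε
  -- The tolerance makes the error at `ξ` less than `ε / 3`; the `+ 1` allows `ξ = 0`.
  obtain ⟨b, hb, hab⟩ := Metric.mem_closure_iff.mp hcl (ε / (3 * (‖ξ‖ + 1))) (by positivity)
  -- A single `b` serves all representations at once, in particular every `π k` and `π'`.
  have hest : ∀ ρ : UnitaryRep G H, dist (ρ.fieldAt a ξ) (ρ.fieldAt b ξ) < ε / 3 := by
    intro ρ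
    have h1 : ρ.fieldAt a ξ - ρ.fieldAt b ξ = ρ.fieldAt (a - b) ξ := rfl
    rw [dist_eq_norm, h1]
    rw [dist_eq_norm] at hab
    have h2 := (ρ.fieldAt (a - b)).le_of_opNorm_le (ρ.norm_fieldAt_le (a - b)) ξ
    have h3 : ‖a - b‖ * ‖ξ‖ ≤ ‖a - b‖ * (‖ξ‖ + 1) := by gcongr; linarith
    have h4 : ‖a - b‖ * (‖ξ‖ + 1) < ε / (3 * (‖ξ‖ + 1)) * (‖ξ‖ + 1) := by gcongr
    have h5 : ε / (3 * (‖ξ‖ + 1)) * (‖ξ‖ + 1) = ε / 3 := by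
      have : ‖ξ‖ + 1 ≠ 0 := by positivity
      field_simp
    linarith
  obtain ⟨N, hN⟩ := Metric.tendsto_atTop.mp ((tendsto_fieldAt_of_mem_adjoin h hb).1 ξ) (ε / 3)
    (by positivity)
  refine ⟨N, fun k hk => ?_⟩
  have h1 := hest (π k)
  have h2 := hest π'
  rw [dist_comm] at h2
  have h3 := dist_triangle4 ((π k).fieldAt a ξ) ((π k).fieldAt b ξ) (π'.fieldAt b ξ)
    (π'.fieldAt a ξ)
  linarith [hN k hk]

end UnitaryRep

/-- Here `n = d + m`, and pointwise convergence of `ℓ` is convergence in the finite dimensional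
dual. The subalgebra `𝔥'` is determined by the Malcev property of `Z'`, and `hiso'` is needed before
the limit representation can be formed. `inner ℂ η` is linear in its second argument, so `inner ℂ η
(σ(a) ξ)` is the matrix coefficient `⟨σ(a) ξ, η⟩` for a product linear on the left. -/
theorem mainTheorem12 {𝔤 : Type*} [LieRing 𝔤] [LieAlgebra ℝ 𝔤] [FiniteDimensional ℝ 𝔤]
    [LieRing.IsNilpotent 𝔤] [TopologicalSpace 𝔤] [IsTopologicalAddGroup 𝔤] [ContinuousSMul ℝ 𝔤]
    [T2Space 𝔤]
    (B : LinearMap.BilinForm ℝ 𝔤) (hBsymm : ∀ x y, B x y = B y x) (hBpos : ∀ x, x ≠ 0 → 0 < B x x)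
    (d m : ℕ)
    (ℓ : ℕ → Module.Dual ℝ 𝔤) (ℓ' : Module.Dual ℝ 𝔤)
    (hℓ : ∀ x, Filter.Tendsto (fun k => ℓ k x) Filter.atTop (nhds (ℓ' x)))
    (𝔥 : ℕ → LieSubalgebra ℝ 𝔤) (hiso : ∀ k, ∀ x ∈ 𝔥 k, ∀ y ∈ 𝔥 k, ℓ k ⁅x, y⁆ = 0)
    (Z : ℕ → Fin (d + m) → 𝔤) (Z' : Fin (d + m) → 𝔤)
    (hZ : ∀ k, IsMalcevBasis (𝔥 k) (Z k))
    (horth : ∀ k i j, B (Z k i) (Z k j) = if i = j then 1 else 0)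
    (hlim : ∀ i, Filter.Tendsto (fun k => Z k i) Filter.atTop (nhds (Z' i))) :
    (∀ i j, B (Z' i) (Z' j) = if i = j then 1 else 0) ∧
    ∃ (𝔥' : LieSubalgebra ℝ 𝔤) (hZ' : IsMalcevBasis 𝔥' Z')
      (hiso' : ∀ x ∈ 𝔥', ∀ y ∈ 𝔥', ℓ' ⁅x, y⁆ = 0),
      ∀ (ξ η : MeasureTheory.Lp ℂ 2
          (MeasureTheory.volume : MeasureTheory.Measure (Fin d → ℝ)))
        (a : groupCStarAlgebra (ExpGroup 𝔤)),
        Filter.Tendsto (fun k => inner ℂ η (((hZ k).inducedRep (ℓ k) (hiso k)).onCStar a ξ)) Filter.atTop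
          (nhds (inner ℂ η ((hZ'.inducedRep ℓ' hiso').onCStar a ξ))) := by
  obtain ⟨𝔥', hZ'⟩ := IsMalcevBasis.exists_of_tendsto B hZ horth hlim
  refine ⟨IsMalcevBasis.orthonormal_of_tendsto B horth hlim, 𝔥', hZ',
    IsMalcevBasis.apply_lie_eq_zero_of_tendsto hZ hZ' hlim hℓ hiso, fun ξ η a => ?_⟩
  have h := UnitaryRep.tendsto_onCStar (π := fun k => (hZ k).inducedRep (ℓ k) (hiso k))
    (π' := hZ'.inducedRep ℓ'
      (IsMalcevBasis.apply_lie_eq_zero_of_tendsto hZ hZ' hlim hℓ hiso))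
    (fun g ξ => IsMalcevBasis.tendsto_inducedOp B horth hlim hℓ g ξ) a ξ
  -- Norm convergence of `σ_k(a) ξ` implies convergence of its pairing with any fixed `η`.
  exact Filter.Tendsto.inner tendsto_const_nhds h
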